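/- A *pseudo-composition* of $n\ge 0$ is a tuple $\alpha=(\alpha_1,\dots,\alpha_k)$, $k\ge 1$, of integers with $\alpha_1\ge 0$, $\alpha_i>0$ for $i>1$ and $\alpha_1+\cdots+\alpha_k=n$; write $l(\alpha)=k$, and $\alpha\le\beta$ if $\beta$ refines $\alpha$, i.e. $\alpha$ arises from $\beta$ by adding up consecutive parts. For an integer $n\ge0$ and an ordinary composition $\alpha$ (a possibly empty tuple of positive integers), $n\alpha$ denotes the pseudo-composition $(n,\alpha_1,\alpha_2,\dots)$. Let $BQSym\subset\mathbb Z[[x_0,x_1,x_2,\dots]]$ be the ring of type B quasisymmetric functions: the power series of bounded degree in which, for every pseudo-composition $\alpha$, the coefficient of $x_0^{\alpha_1}x_{i_2}^{\alpha_2}\cdots x_{i_k}^{\alpha_k}$ is the same for all $0<i_2<\cdots<i_k$. Put $$M_\alpha=\sum_{0<i_2<\cdots<i_k}x_0^{\alpha_1}x_{i_2}^{\alpha_2}\cdots x_{i_k}^{\alpha_k},\qquad F_\alpha=\sum_{\alpha\le\beta}M_\beta,\qquad K_\alpha=\sum_{\alpha\le\beta^*}2^{l(\beta)-1}M_\beta,$$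 where $\beta$ ranges over pseudo-compositions of $|\alpha|$ and $\beta^*$ is obtained from $\beta$ by replacing every part $\beta_i\ge2$ with $i>1$ by the two parts $(1,\beta_i-1)$. Let $\widehat\alpha$ be obtained from $\alpha$ by keeping $\alpha_1$ and replacing, in $(\alpha_2,\dots,\alpha_k)$, every maximal run of parts equal to $1$ by its sum, added to the next part on the right (a run at the end is replaced by its sum). Let $\Pi_B$ be the $\mathbb Z$-span of the $K_\alpha$ over all $\alpha$ whose middle parts $\alpha_2,\dots,\alpha_{k-1}$ are all greater than $1$. **Theorem.** With the product of power series, the constant term as counit, and the coproduct $$\Delta(M_{n\alpha})=\sum_{\beta\gamma=\alpha}\sum_{i=0}^n\binom ni M_{i\beta}\otimes M_{(n-i)\gamma}\qquad(n\ge0,\ \alpha\text{ an ordinary composition},\ \beta\gamma\text{ the concatenation}),$$ $BQSym$ is a Hopf algebra over $\mathbb Z$. There is exactly one $\mathbb Z$-linear map $\Theta_B: BQSym\to BQSym$ with $\Theta_B(F_\alpha)=K_{\widehat\alpha}$ for all pseudo-compositions $\alpha$, and it is a homomorphism of Hopf algebras. Its image is $\Pi_B$, and $\Pi_B$ is a Hopf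 subalgebra of $BQSym$. Moreover $\Theta_B(M_1)=M_1$; and if $QSym\subset BQSym$ denotes the subring of series not involving $x_0$, then $\Theta_B$ maps $QSym$ into itself and corresponds to $\mathrm{id}\otimes\Theta_B|_{QSym}$ under the ring isomorphism $\mathbb Z[X]\otimes QSym\cong BQSym$, $p\otimes q\mapsto p(M_1)\,q$. -/

import Mathlib

open scoped TensorProduct

/-- A pseudo-composition `(α₁, α₂, …, α_k)`, `k ≥ 1`: the first part `head = α₁` is any natural
number, the remaining parts `tail = (α₂, …, α_k)` are positive, so `tail` is an ordinary
composition. (The empty pseudo-composition of `0` is identified with `(0)`.) -/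
@[ext]
structure PseudoComposition where
  head : ℕ
  tail : List ℕ
  tail_pos : ∀ x ∈ tail, 0 < x

namespace PseudoComposition

/-- `|α|`, the sum of the parts. -/
def size (α : PseudoComposition) : ℕ := α.head + α.tail.sum

/-- `{α₁, α₁ + α₂, …, α₁ + ⋯ + α_{k-1}}`: the set of partial sums, the total sum excluded. -/
def partialSums (α : PseudoComposition) : Finset ℕ :=
  (Finset.range α.tail.length).image fun j => α.head + (α.tail.take j).sum

/-- `α.Le β`: the pseudo-composition `β` refines `α` (that is, `α` arises from `β` by adding up
consecutive parts). -/
def Le (α β : PseudoComposition) : Prop :=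
  α.size = β.size ∧ α.partialSums ⊆ β.partialSums

/-- The finite set of all pseudo-compositions of `n`. -/
noncomputable def ofSize (n : ℕ) : Finset PseudoComposition :=
  open scoped Classical in
  (Finset.range (n + 1)).biUnion fun a =>
    (Finset.univ : Finset (Composition (n - a))).image fun c =>
      ⟨a, c.blocks, fun _ hx => c.blocks_pos hx⟩

theorem mem_ofSize {n : ℕ} {α : PseudoComposition} : α ∈ ofSize n ↔ α.size = n := by
  classical
  simp only [ofSize, Finset.mem_biUnion, Finset.mem_range, Finset.mem_image, Finset.mem_univ,
    true_and]
  constructor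
  · rintro ⟨a, ha, c, rfl⟩
    simp only [size, c.blocks_sum]
    omega
  · intro h
    unfold size at h
    refine ⟨α.head, by omega, ⟨α.tail, fun {x} hx => α.tail_pos x hx, by omega⟩, rfl⟩

/-- `β*`: every part `β_i ≥ 2` with `i > 1` is replaced by the two parts `(1, β_i - 1)`. -/
def star (β : PseudoComposition) : PseudoComposition where
  head := β.head
  tail := β.tail.flatMap fun b => if 2 ≤ b then [1, b - 1] else [b]
  tail_pos := by
    intro x hx
    obtain ⟨b, hb, hx⟩ := List.mem_flatMap.1 hx
    have hb0 := β.tail_pos b hb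
    split_ifs at hx with h <;> simp at hx <;> omega

/-- Auxiliary to `hat`: `hatList r β` is the result for an ordinary composition `β` preceded by
a run of `r` parts equal to `1`. -/
def hatList : ℕ → List ℕ → List ℕ
  | r, [] => if r = 0 then [] else [r]
  | r, b :: t => if b = 1 then hatList (r + 1) t else (b + r) :: hatList 0 t

theorem hatList_pos (l : List ℕ) :
    ∀ r : ℕ, (∀ x ∈ l, 0 < x) → ∀ x ∈ hatList r l, 0 < x := by
  induction l with
  | nil =>
    intro r _ x hx
    by_cases h : r = 0
    · simp [hatList, h] at hx
    · simp [hatList, h] at hx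
      omega
  | cons b t ih =>
    intro r hl x hx
    have hb : 0 < b := hl b (by simp)
    have ht : ∀ x ∈ t, 0 < x := fun x hx => hl x (by simp [hx])
    by_cases h : b = 1
    · simp only [hatList, h, if_true] at hx
      exact ih _ ht x hx
    · simp only [hatList, h, if_false, List.mem_cons] at hx
      rcases hx with rfl | hx
      · omega
      · exact ih _ ht x hx

/-- `α̂`: the first part is kept, and in `(α₂, …, α_k)` every maximal run of parts equal to `1` is
replaced by its sum, which is added to the next part to the right if there is one. -/
def hat (α : PseudoComposition) : PseudoComposition where
  head := α.head
  tail := hatList 0 α.tail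
  tail_pos := hatList_pos α.tail 0 α.tail_pos

/-- Type B peak pseudo-compositions: the middle parts `α₂, …, α_{k-1}` are all greater than `1`. -/
def IsPeak (α : PseudoComposition) : Prop := ∀ x ∈ α.tail.dropLast, 1 < x

/-- The exponent of the monomial `x_0^{α₁} x_{i_2}^{α₂} ⋯ x_{i_k}^{α_k}`. -/
noncomputable def exponent (α : PseudoComposition) (i : Fin α.tail.length → ℕ) : ℕ →₀ ℕ :=
  Finsupp.single 0 α.head + ∑ j, Finsupp.single (i j) (α.tail.get j)

theorem mapDomain_exponent (α : PseudoComposition) (i : Fin α.tail.length → ℕ) {φ : ℕ → ℕ}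
    (h0 : φ 0 = 0) : (α.exponent i).mapDomain φ = α.exponent (φ ∘ i) := by
  simp [exponent, Finsupp.mapDomain_add, Finsupp.mapDomain_finsetSum, h0]

theorem degree_exponent (α : PseudoComposition) (i : Fin α.tail.length → ℕ) :
    (α.exponent i).degree = α.size := by
  simp only [exponent, size, map_add, map_sum, Finsupp.degree_single]
  congr 1
  exact Fin.sum_univ_getElem α.tail

theorem pos_exponent (α : PseudoComposition) (i : Fin α.tail.length → ℕ)
    (j : Fin α.tail.length) : 0 < α.exponent i (i j) := by
  have h : 0 < α.tail.get j := α.tail_pos _ (List.get_mem _ _)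
  have h2 : Finsupp.single (i j) (α.tail.get j) ≤ α.exponent i :=
    (Finset.single_le_sum (f := fun j => Finsupp.single (i j) (α.tail.get j))
      (fun _ _ => zero_le) (Finset.mem_univ j)).trans le_add_self
  have h3 := h2 (i j)
  rw [Finsupp.single_eq_same] at h3
  omega

theorem exists_exponent_eq (d : ℕ →₀ ℕ) : ∃ (α : PseudoComposition)
    (i : Fin α.tail.length → ℕ), StrictMono i ∧ (∀ j, 0 < i j) ∧ α.exponent i = d := by
  classical
  let s := d.support.erase 0
  let e := s.orderEmbOfFin rfl
  have hmem : ∀ j, e j ∈ s := fun j => s.orderEmbOfFin_mem rfl j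
  have hs : ∀ x ∈ s, x ≠ 0 ∧ d x ≠ 0 := by
    intro x hx
    simpa [s] using hx
  let α : PseudoComposition := ⟨d 0, List.ofFn fun j => d (e j), by
    intro x hx
    obtain ⟨j, rfl⟩ := (List.mem_ofFn' _ _).1 hx
    exact Nat.pos_of_ne_zero (hs _ (hmem j)).2⟩
  have hl : α.tail.length = s.card := by simp [α]
  refine ⟨α, fun j => e (Fin.cast hl j), ?_, ?_, ?_⟩
  · intro a b hab
    exact e.strictMono (by simpa using hab)
  · intro j
    exact Nat.pos_of_ne_zero (hs _ (hmem _)).1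
  · have h1 : ∑ j, Finsupp.single (e (Fin.cast hl j)) (α.tail.get j) =
        ∑ j : Fin s.card, Finsupp.single (e j) (d (e j)) := by
      refine Fintype.sum_equiv (finCongr hl) _ _ fun j => ?_
      simp only [α, List.get_ofFn, finCongr_apply]
    have h2 : ∑ j : Fin s.card, Finsupp.single (e j) (d (e j)) =
        ∑ x ∈ s, Finsupp.single x (d x) := by
      rw [← Finset.sum_coe_sort s]
      exact Fintype.sum_equiv (s.orderIsoOfFin rfl).toEquiv _ _ fun j => rfl
    simp only [exponent]
    rw [h1, h2]
    ext x
    simp only [Finsupp.add_apply, Finsupp.finsetSum_apply, Finsupp.single_apply]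
    rw [Finset.sum_ite_eq' s x]
    by_cases hx : x = 0
    · subst hx
      simp [s, α]
    · by_cases hd : d x = 0
      · simp [s, hx, hd, Ne.symm hx]
      · simp [s, hx, hd, Ne.symm hx]

end PseudoComposition

/-- Type B quasisymmetric functions: power series in `x_0, x_1, x_2, …` over `ℤ`, of bounded
degree, such that for every pseudo-composition `α` the coefficient of
`x_0^{α₁} x_{i_2}^{α₂} ⋯ x_{i_k}^{α_k}` is the same for all `0 < i_2 < ⋯ < i_k`. -/
def IsTypeBQuasisymmetric (f : MvPowerSeries ℕ ℤ) : Prop :=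
  (∃ N : ℕ, ∀ d : ℕ →₀ ℕ, MvPowerSeries.coeff d f ≠ 0 → d.degree ≤ N) ∧
  ∀ (α : PseudoComposition) (i : Fin α.tail.length → ℕ), StrictMono i → (∀ j, 0 < i j) →
    MvPowerSeries.coeff (α.exponent i) f =
      MvPowerSeries.coeff (α.exponent fun j => (j : ℕ) + 1) f

theorem IsTypeBQuasisymmetric.coeff_mapDomain {f : MvPowerSeries ℕ ℤ}
    (hf : IsTypeBQuasisymmetric f) {φ : ℕ → ℕ} (hφ : StrictMono φ) (h0 : φ 0 = 0)
    (d : ℕ →₀ ℕ) :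
    MvPowerSeries.coeff (d.mapDomain φ) f = MvPowerSeries.coeff d f := by
  obtain ⟨α, i, hi, hpos, rfl⟩ := PseudoComposition.exists_exponent_eq d
  rw [α.mapDomain_exponent i h0, hf.2 α i hi hpos, hf.2 α (φ ∘ i) (hφ.comp hi)]
  intro j
  rw [← h0]
  exact hφ (hpos j)

theorem IsTypeBQuasisymmetric.of_coeff_mapDomain {f : MvPowerSeries ℕ ℤ}
    (hb : ∃ N : ℕ, ∀ d : ℕ →₀ ℕ, MvPowerSeries.coeff d f ≠ 0 → d.degree ≤ N)
    (hf : ∀ φ : ℕ → ℕ, StrictMono φ → φ 0 = 0 → ∀ d : ℕ →₀ ℕ,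
      MvPowerSeries.coeff (d.mapDomain φ) f = MvPowerSeries.coeff d f) :
    IsTypeBQuasisymmetric f := by
  refine ⟨hb, fun α i hi hpos => ?_⟩
  let φ : ℕ → ℕ := fun m => if m = 0 then 0 else
    if h : m - 1 < α.tail.length then i ⟨m - 1, h⟩ else (∑ j, i j) + m
  have h0 : φ 0 = 0 := by simp [φ]
  have hle : ∀ j, i j ≤ ∑ j, i j := fun j =>
    Finset.single_le_sum (f := i) (fun _ _ => Nat.zero_le _) (Finset.mem_univ j)
  have hφ : StrictMono φ := by
    intro a b hab
    have hb0 : b ≠ 0 := by omega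
    by_cases ha0 : a = 0
    · simp only [φ, ha0, hb0, if_true, if_false]
      split_ifs
      · exact hpos _
      · omega
    · simp only [φ, ha0, hb0, if_false]
      split_ifs with h1 h2 h2
      · apply hi
        simp only [Fin.mk_lt_mk]
        omega
      · have := hle ⟨a - 1, h1⟩
        omega
      · omega
      · omega
  have h : (α.exponent fun j => (j : ℕ) + 1).mapDomain φ = α.exponent i := by
    rw [α.mapDomain_exponent _ h0]
    congr 1
    funext j
    simp [φ]
  rw [← h, hf φ hφ h0]

/-- The ring `BQSym` of type B quasisymmetric functions, with the product of power series. -/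
def BQSym : Subring (MvPowerSeries ℕ ℤ) where
  carrier := {f | IsTypeBQuasisymmetric f}
  add_mem' := by
    rintro f g ⟨⟨N, hN⟩, hf⟩ ⟨⟨N', hN'⟩, hg⟩
    refine ⟨⟨max N N', fun d hd => ?_⟩, fun α i hi hpos => ?_⟩
    · by_cases h : MvPowerSeries.coeff d f = 0
      · exact (hN' d (by simpa [h] using hd)).trans (le_max_right _ _)
      · exact (hN d h).trans (le_max_left _ _)
    · rw [map_add, map_add, hf α i hi hpos, hg α i hi hpos]
  mul_mem' := by
    classical
    intro f g hf hg
    refine IsTypeBQuasisymmetric.of_coeff_mapDomain ?_ ?_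
    · obtain ⟨N, hN⟩ := hf.1
      obtain ⟨N', hN'⟩ := hg.1
      refine ⟨N + N', fun d hd => ?_⟩
      rw [MvPowerSeries.coeff_mul] at hd
      obtain ⟨p, hp, hne⟩ := Finset.exists_ne_zero_of_sum_ne_zero hd
      rw [← Finset.HasAntidiagonal.mem_antidiagonal.1 hp, map_add]
      exact add_le_add (hN _ (left_ne_zero_of_mul hne)) (hN' _ (right_ne_zero_of_mul hne))
    · intro φ hφ h0 d
      rw [MvPowerSeries.coeff_mul, MvPowerSeries.coeff_mul]
      symm
      refine Finset.sum_nbij (fun p => (p.1.mapDomain φ, p.2.mapDomain φ)) ?_ ?_ ?_ ?_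
      · intro p hp
        rw [Finset.HasAntidiagonal.mem_antidiagonal] at hp ⊢
        rw [← hp, Finsupp.mapDomain_add]
      · intro p _ q _ h
        have h1 := Finsupp.mapDomain_injective hφ.injective (congrArg Prod.fst h)
        have h2 := Finsupp.mapDomain_injective hφ.injective (congrArg Prod.snd h)
        exact Prod.ext h1 h2
      · rintro ⟨p, q⟩ hpq
        rw [Finset.mem_coe, Finset.HasAntidiagonal.mem_antidiagonal] at hpq
        have hsupp : ∀ r : ℕ →₀ ℕ, r ≤ d.mapDomain φ → (r.support : Set ℕ) ⊆ Set.range φ := by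
          intro r hr x hx
          have hx' : x ∈ (d.mapDomain φ).support := by
            have := hr x
            simp only [Finset.mem_coe, Finsupp.mem_support_iff] at hx ⊢
            omega
          obtain ⟨y, _, hy⟩ := Finset.mem_image.1 (Finsupp.mapDomain_support hx')
          exact ⟨y, hy⟩
        have hp := Finsupp.mapDomain_comapDomain φ hφ.injective p
          (hsupp p (by rw [← hpq]; exact le_self_add))
        have hq := Finsupp.mapDomain_comapDomain φ hφ.injective q
          (hsupp q (by rw [← hpq]; exact le_add_self))
        refine ⟨(p.comapDomain φ hφ.injective.injOn, q.comapDomain φ hφ.injective.injOn),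
          ?_, ?_⟩
        · rw [Finset.mem_coe, Finset.HasAntidiagonal.mem_antidiagonal]
          apply Finsupp.mapDomain_injective hφ.injective
          rw [Finsupp.mapDomain_add, hp, hq]
          exact hpq
        · exact Prod.ext hp hq
      · intro p _
        rw [hf.coeff_mapDomain hφ h0, hg.coeff_mapDomain hφ h0]
  zero_mem' := ⟨⟨0, fun d hd => absurd (map_zero _) hd⟩, fun α i _ _ => by simp⟩
  one_mem' := by
    classical
    refine IsTypeBQuasisymmetric.of_coeff_mapDomain ⟨0, fun d hd => ?_⟩ fun φ hφ h0 d => ?_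
    · rw [MvPowerSeries.coeff_one] at hd
      have : d = 0 := by
        by_contra h
        simp [h] at hd
      simp [this]
    · have : d.mapDomain φ = 0 ↔ d = 0 :=
        ⟨fun h => Finsupp.mapDomain_injective hφ.injective (by simpa using h),
          fun h => by simp [h]⟩
      rw [MvPowerSeries.coeff_one, MvPowerSeries.coeff_one]
      simp only [this]
  neg_mem' := by
    rintro f ⟨⟨N, hN⟩, hf⟩
    refine ⟨⟨N, fun d hd => hN d (by simpa using hd)⟩, fun α i hi hpos => ?_⟩
    rw [map_neg, map_neg, hf α i hi hpos]

namespace BQSym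

open scoped Classical in
/-- The power series `∑_{0 < i_2 < ⋯ < i_k} x_0^{α₁} x_{i_2}^{α₂} ⋯ x_{i_k}^{α_k}`. Since
`α₂, …, α_k` are positive, its monomials are pairwise distinct, so each coefficient is `0` or
`1`. -/
noncomputable def monomialSeries (α : PseudoComposition) : MvPowerSeries ℕ ℤ := fun d =>
  if ∃ i : Fin α.tail.length → ℕ, StrictMono i ∧ (∀ j, 0 < i j) ∧ d = α.exponent i then 1 else 0

theorem monomialSeries_mem (α : PseudoComposition) : monomialSeries α ∈ BQSym := by
  classical
  have hc : ∀ d, MvPowerSeries.coeff d (monomialSeries α) =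
      if ∃ i : Fin α.tail.length → ℕ, StrictMono i ∧ (∀ j, 0 < i j) ∧ d = α.exponent i
      then 1 else 0 := fun _ => rfl
  refine IsTypeBQuasisymmetric.of_coeff_mapDomain ⟨α.size, fun d hd => ?_⟩ fun φ hφ h0 d => ?_
  · rw [hc] at hd
    obtain ⟨i, _, _, rfl⟩ : ∃ i : Fin α.tail.length → ℕ,
        StrictMono i ∧ (∀ j, 0 < i j) ∧ d = α.exponent i := by
      by_contra h
      simp [h] at hd
    exact (α.degree_exponent i).le
  · rw [hc, hc]
    refine if_congr ⟨?_, ?_⟩ rfl rfl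
    · rintro ⟨i, hi, hpos, he⟩
      have hr : ∀ j, ∃ m, φ m = i j := by
        intro j
        have hj : i j ∈ (d.mapDomain φ).support := by
          rw [he, Finsupp.mem_support_iff]
          exact (α.pos_exponent i j).ne'
        obtain ⟨y, _, hy⟩ := Finset.mem_image.1 (Finsupp.mapDomain_support hj)
        exact ⟨y, hy⟩
      choose m hm using hr
      refine ⟨m, fun a b hab => ?_, fun j => ?_, ?_⟩
      · rw [← hφ.lt_iff_lt, hm, hm]
        exact hi hab
      · rw [← hφ.lt_iff_lt, hm, h0]
        exact hpos j
      · apply Finsupp.mapDomain_injective hφ.injective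
        rw [he, α.mapDomain_exponent m h0]
        congr 1
        funext j
        exact (hm j).symm
    · rintro ⟨i, hi, hpos, rfl⟩
      refine ⟨φ ∘ i, hφ.comp hi, fun j => ?_, α.mapDomain_exponent i h0⟩
      rw [← h0]
      exact hφ (hpos j)

/-- The monomial type B quasisymmetric function `M_α`. -/
noncomputable def M (α : PseudoComposition) : BQSym := ⟨monomialSeries α, monomialSeries_mem α⟩

open scoped Classical in
/-- The fundamental type B quasisymmetric function `F_α = ∑_{α ≤ β} M_β`. -/
noncomputable def F (α : PseudoComposition) : BQSym :=
  ∑ β ∈ (PseudoComposition.ofSize α.size).filter fun β => α.Le β, M β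

open scoped Classical in
/-- `K_α = ∑_{α ≤ β*} 2^{l(β) - 1} M_β`, the sum over pseudo-compositions `β` of `|α|`. -/
noncomputable def K (α : PseudoComposition) : BQSym :=
  ∑ β ∈ (PseudoComposition.ofSize α.size).filter fun β => α.Le β.star,
    (2 : BQSym) ^ β.tail.length * M β

/-- The type B peak functions `Π_B`: the `ℤ`-span of the `K_α`, for `α` a type B peak
pseudo-composition. -/
noncomputable def peakFunctions : Submodule ℤ BQSym :=
  Submodule.span ℤ {f | ∃ α : PseudoComposition, α.IsPeak ∧ f = K α}

/-- The ordinary quasisymmetric functions, as the subring of `BQSym` of all series that do not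
involve `x_0`. -/
def QSym : Subring BQSym where
  carrier := {f | ∀ d : ℕ →₀ ℕ, d 0 ≠ 0 → MvPowerSeries.coeff d (f : MvPowerSeries ℕ ℤ) = 0}
  add_mem' := by
    intro f g hf hg d hd
    rw [Subring.coe_add, map_add, hf d hd, hg d hd, add_zero]
  mul_mem' := by
    classical
    intro f g hf hg d hd
    rw [Subring.coe_mul, MvPowerSeries.coeff_mul]
    refine Finset.sum_eq_zero fun p hp => ?_
    rw [Finset.HasAntidiagonal.mem_antidiagonal] at hp
    by_cases h : p.1 0 = 0
    · have h2 : p.2 0 ≠ 0 := by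
        intro h2
        rw [← hp, Finsupp.add_apply, h, h2] at hd
        exact hd rfl
      rw [hg _ h2, mul_zero]
    · rw [hf _ h, zero_mul]
  zero_mem' := fun d _ => map_zero _
  one_mem' := by
    classical
    intro d hd
    have h : d ≠ 0 := by
      rintro rfl
      exact hd rfl
    rw [Subring.coe_one, MvPowerSeries.coeff_one, if_neg h]
  neg_mem' := by
    intro f hf d hd
    rw [Subring.coe_neg, map_neg, hf d hd, neg_zero]

end BQSym

/-- The algebra `A` with its coalgebra structure is a bialgebra (counit and comultiplication are
ring homomorphisms), and `S` is an antipode for it, so `A` is a Hopf algebra. (The axioms are those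
of `HopfAlgebra R A`, for given algebra and coalgebra structures.) -/
structure IsHopfAlgebra {R A : Type*} [CommRing R] [CommRing A] [Algebra R A] [Coalgebra R A]
    (S : A →ₗ[R] A) : Prop where
  counit_one : Coalgebra.counit (R := R) (1 : A) = 1
  counit_mul : ∀ a b : A, Coalgebra.counit (R := R) (a * b) =
    Coalgebra.counit (R := R) a * Coalgebra.counit (R := R) b
  comul_one : Coalgebra.comul (R := R) (1 : A) = 1
  comul_mul : ∀ a b : A, Coalgebra.comul (R := R) (a * b) =
    Coalgebra.comul (R := R) a * Coalgebra.comul (R := R) b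
  mul_antipode_rTensor_comul : LinearMap.mul' R A ∘ₗ S.rTensor A ∘ₗ Coalgebra.comul =
    Algebra.linearMap R A ∘ₗ Coalgebra.counit
  mul_antipode_lTensor_comul : LinearMap.mul' R A ∘ₗ S.lTensor A ∘ₗ Coalgebra.comul =
    Algebra.linearMap R A ∘ₗ Coalgebra.counit

/-- The subalgebra `P` of the Hopf algebra `A` with antipode `S` is a Hopf subalgebra: the map
`P ⊗ P → A ⊗ A` is injective (so that `P ⊗ P` is a submodule of `A ⊗ A`), `Δ(P) ⊆ P ⊗ P` and
`S(P) ⊆ P`. -/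
structure IsHopfSubalgebra {R A : Type*} [CommRing R] [CommRing A] [Algebra R A] [Coalgebra R A]
    (S : A →ₗ[R] A) (P : Subalgebra R A) : Prop where
  tensor_injective :
    Function.Injective (TensorProduct.map P.val.toLinearMap P.val.toLinearMap)
  comul_mem : ∀ x ∈ P, Coalgebra.comul (R := R) x ∈
    LinearMap.range (TensorProduct.map P.val.toLinearMap P.val.toLinearMap)
  antipode_mem : ∀ x ∈ P, S x ∈ P

/-- The coalgebra structure of `BQSym`: the counit is the constant term, and
`Δ(M_{nα}) = ∑_{βγ = α} ∑_{i=0}^n (n choose i) M_{iβ} ⊗ M_{(n-i)γ}` for every `n` and every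
ordinary composition `α`. -/
def BQSym.HasStandardCoalgebra [Coalgebra ℤ BQSym] : Prop :=
  (∀ f : BQSym, Coalgebra.counit (R := ℤ) f =
    MvPowerSeries.constantCoeff (f : MvPowerSeries ℕ ℤ)) ∧
  ∀ (n : ℕ) (α : List ℕ) (hα : ∀ x ∈ α, 0 < x),
    Coalgebra.comul (R := ℤ) (BQSym.M ⟨n, α, hα⟩) =
      ∑ j ∈ Finset.range (α.length + 1), ∑ i ∈ Finset.range (n + 1),
        n.choose i •
          (BQSym.M ⟨i, α.take j, fun x hx => hα x (List.mem_of_mem_take hx)⟩ ⊗ₜ[ℤ]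
            BQSym.M ⟨n - i, α.drop j, fun x hx => hα x (List.mem_of_mem_drop hx)⟩)

/-! Since M_{nα} = x₀ⁿ M_{0α}, the ring `BQSym` is a polynomial ring in x₀ over the span of the
`mono l`, which multiply by the quasi-shuffle product. The map Θ_B is built on this basis rather
than on the F_α: it fixes x₀ and sends `mono l` to `peak l`. Here `peak l` sums over all ways to
merge `l` into consecutive blocks, and a block (a₁,…,a_r) has weight ε(a₁)⋯ε(a_{r-1})(1 + ε(a_r))
with ε(a) = (-1)^(a-1).

Multiplicativity: for a finite alphabet, evaluating `peak l` is the same as evaluating `l` at a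
doubled alphabet (`lift_eval_peak`), where each variable x contributes the convolution of the
inverse of the character at -x with the character at x. Convolutions of characters are characters
(`isCharacter_superEval`), and a power series identity of this kind can be tested on finite
alphabets (`ofWords_mul_ofWords`).

Coproduct: x₀ is primitive and the rest is deconcatenation. Cutting a merged word between two blocks
amounts to cutting the original word and merging both pieces independently, so `peak` respects
deconcatenation (`comulHom_peak_and_openPeak`). The antipode is a convolution inverse of the
identity, hence it commutes with every bialgebra endomorphism.

The formula Θ_B(F_α) = K_α̂: pseudo-compositions of n are binary words of length n, refinement is
the pointwise order, and star and hat become B ∪ (B+1) and B \ (B+1). Summing `peak` over all words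
above a given one, the signs ε cancel in pairs (`sum_closing_continuing`), leaving coefficients
given by a two-state recursion, which are exactly those of K_α̂ (`weight_eq`). As the F_α span, Θ_B
is unique; as every hat is a peak pseudo-composition and hat fixes those, the image is Π_B. -/

namespace QuasiShuffle

/-! ### The quasi-shuffle product on compositions. -/

/-- The free abelian group on ordinary compositions. -/
abbrev Words : Type := List ℕ+ →₀ ℤ

/-- The composition `l` as a basis element of `Words`. -/
noncomputable abbrev of (l : List ℕ+) : Words := Finsupp.single l 1

/-- Prepending the part `a`. -/
noncomputable def cons (a : ℕ+) : Words →ₗ[ℤ] Words := Finsupp.lmapDomain ℤ ℤ (List.cons a)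

@[simp]
theorem cons_of (a : ℕ+) (l : List ℕ+) : cons a (of l) = of (a :: l) := by
  simp [cons]

/-- The quasi-shuffle product of two compositions. -/
noncomputable def prod : List ℕ+ → List ℕ+ → Words
  | [], l => of l
  | a :: l, [] => of (a :: l)
  | a :: l, b :: k =>
    cons a (prod l (b :: k)) + cons b (prod (a :: l) k) + cons (a + b) (prod l k)
termination_by l k => l.length + k.length

theorem prod_nil_left (l : List ℕ+) : prod [] l = of l := by rw [prod]

theorem prod_nil_right (l : List ℕ+) : prod l [] = of l := by cases l <;> rw [prod]

theorem prod_cons_cons (a b : ℕ+) (l k : List ℕ+) : prod (a :: l) (b :: k) =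
    cons a (prod l (b :: k)) + cons b (prod (a :: l) k) + cons (a + b) (prod l k) := by rw [prod]

/-! ### Characters of the quasi-shuffle algebra and their convolution. -/

section Character

variable {D : Type*} [CommRing D]

/-- The linear extension of a function on compositions. -/
noncomputable abbrev lift (u : List ℕ+ → D) : Words →ₗ[ℤ] D := Finsupp.linearCombination ℤ u

theorem lift_of (u : List ℕ+ → D) (l : List ℕ+) : lift u (of l) = u l := by simp [lift]

theorem words_hom_ext {E : Type*} [AddCommMonoid E] [Module ℤ E] {f g : Words →ₗ[ℤ] E}
    (h : ∀ l, f (of l) = g (of l)) : f = g :=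
  Finsupp.lhom_ext' fun l => LinearMap.ext_ring (h l)

/-- `u` is multiplicative for the quasi-shuffle product. -/
structure IsCharacter (u : List ℕ+ → D) : Prop where
  map_nil : u [] = 1
  map_prod : ∀ l k, lift u (prod l k) = u l * u k

/-- The function with value `1` at the empty composition and `0` elsewhere. -/
def unitCharacter : List ℕ+ → D
  | [] => 1
  | _ :: _ => 0

theorem lift_unitCharacter_cons (a : ℕ+) (f : Words) :
    lift (unitCharacter (D := D)) (cons a f) = 0 := by
  have : lift (unitCharacter (D := D)) ∘ₗ cons a = 0 :=
    words_hom_ext fun l => by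
      rw [LinearMap.comp_apply, cons_of, lift_of, LinearMap.zero_apply, unitCharacter]
  exact DFunLike.congr_fun this f

theorem isCharacter_unitCharacter : IsCharacter (unitCharacter (D := D)) where
  map_nil := rfl
  map_prod l k := by
    rcases l with _ | ⟨a, l⟩
    · rw [prod_nil_left, lift_of, unitCharacter, one_mul]
    rcases k with _ | ⟨b, k⟩
    · rw [prod_nil_right, lift_of, unitCharacter, unitCharacter, mul_one]
    simp only [prod_cons_cons, map_add, lift_unitCharacter_cons, unitCharacter, mul_zero, add_zero]

/-- Convolution on the left with the character `[a] ↦ x ^ a`, `[a, b, …] ↦ 0`. -/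
def zetaStep (x : D) (u : List ℕ+ → D) : List ℕ+ → D
  | [] => u []
  | a :: l => u (a :: l) + x ^ (a : ℕ) * u l

/-- Convolution on the left with the character `[a₁, …, a_k] ↦ (-1) ^ k (-x) ^ (a₁ + ⋯ + a_k)`. -/
def sigmaStep (x : D) (u : List ℕ+ → D) : List ℕ+ → D
  | [] => u []
  | a :: l => u (a :: l) - (-x) ^ (a : ℕ) * sigmaStep x u l

theorem lift_zetaStep_cons (x : D) (u : List ℕ+ → D) (a : ℕ+) (f : Words) :
    lift (zetaStep x u) (cons a f) = lift u (cons a f) + x ^ (a : ℕ) * lift u f := by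
  have : lift (zetaStep x u) ∘ₗ cons a =
      lift u ∘ₗ cons a + LinearMap.mulLeft ℤ (x ^ (a : ℕ)) ∘ₗ lift u :=
    words_hom_ext fun l => by
      simp only [LinearMap.comp_apply, LinearMap.add_apply, LinearMap.mulLeft_apply, cons_of,
        lift_of, zetaStep]
  exact DFunLike.congr_fun this f

theorem lift_sigmaStep_cons (x : D) (u : List ℕ+ → D) (a : ℕ+) (f : Words) :
    lift (sigmaStep x u) (cons a f) =
      lift u (cons a f) - (-x) ^ (a : ℕ) * lift (sigmaStep x u) f := by
  have : lift (sigmaStep x u) ∘ₗ cons a =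
      lift u ∘ₗ cons a - LinearMap.mulLeft ℤ ((-x) ^ (a : ℕ)) ∘ₗ lift (sigmaStep x u) :=
    words_hom_ext fun l => by
      simp only [LinearMap.comp_apply, LinearMap.sub_apply, LinearMap.mulLeft_apply, cons_of,
        lift_of, sigmaStep]
  exact DFunLike.congr_fun this f

/-- The variable x takes at most one part, so a single layer of the quasi-shuffle recursion
suffices: the three terms stripped of their first part, together with the untouched product, are the
four terms of the expanded right side. No induction is needed. -/
theorem IsCharacter.zetaStep {u : List ℕ+ → D} (hu : IsCharacter u) (x : D) :
    IsCharacter (zetaStep x u) where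
  map_nil := hu.map_nil
  map_prod l k := by
    rcases l with _ | ⟨a, l⟩
    · rw [prod_nil_left, lift_of, QuasiShuffle.zetaStep, hu.map_nil, one_mul]
    rcases k with _ | ⟨b, k⟩
    · rw [prod_nil_right, lift_of, QuasiShuffle.zetaStep.eq_1, hu.map_nil, mul_one]
    have h := hu.map_prod (a :: l) (b :: k)
    rw [prod_cons_cons, map_add, map_add] at h
    simp only [prod_cons_cons, map_add, lift_zetaStep_cons, hu.map_prod, QuasiShuffle.zetaStep,
      PNat.add_coe, pow_add]
    linear_combination h

/-- `sigmaStep x` undoes `zetaStep (-x)`, so it may strip a prefix of any length. Hence the double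
induction, which supplies the products of the already shortened words. -/
theorem IsCharacter.sigmaStep {u : List ℕ+ → D} (hu : IsCharacter u) (x : D) :
    IsCharacter (sigmaStep x u) where
  map_nil := hu.map_nil
  map_prod l := by
    induction l with
    | nil => intro k; rw [prod_nil_left, lift_of, QuasiShuffle.sigmaStep, hu.map_nil, one_mul]
    | cons a l ihl =>
      intro k
      induction k with
      | nil => rw [prod_nil_right, lift_of, QuasiShuffle.sigmaStep.eq_1, hu.map_nil, mul_one]
      | cons b k ihk =>
        have h := hu.map_prod (a :: l) (b :: k)
        rw [prod_cons_cons, map_add, map_add] at h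
        simp only [prod_cons_cons, map_add, lift_sigmaStep_cons, ihl, ihk,
          QuasiShuffle.sigmaStep, PNat.add_coe, pow_add]
        linear_combination h

end Character

/-! ### The peak map on compositions. -/

/-- The sign `(-1) ^ (a - 1)`, which is `1` for odd and `-1` for even `a`. -/
def sgn (a : ℕ+) : ℤ := -(-1) ^ (a : ℕ)

/-- The peak map on `Words` together with an auxiliary map, computed jointly: the second component
at `s` is the sum over all ways in which a block of size `s` can be continued. -/
noncomputable def peakAux : List ℕ+ → Words × (ℕ+ → Words)
  | [] => (of [], fun s => of [s])
  | a :: l =>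
    let g := cons a (peakAux l).1 + sgn a • (peakAux l).2 a
    (g, fun s => cons s g + cons (s + a) (peakAux l).1 + sgn a • (peakAux l).2 (s + a))

/-- The peak map on compositions. -/
noncomputable def peak (l : List ℕ+) : Words := (peakAux l).1

/-- The sum of all continuations of an open block of size `s` by `l`. -/
noncomputable def openPeak (s : ℕ+) (l : List ℕ+) : Words := (peakAux l).2 s

theorem peak_nil : peak [] = of [] := rfl

theorem openPeak_nil (s : ℕ+) : openPeak s [] = of [s] := rfl

/-- The part a either ends its block, with weight 1, or leaves the block open, with weight `sgn a`.
An open block may still be closed before the next part, so a block (a₁,…,a_r) receives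
ε(a₁)⋯ε(a_{r-1}) once with factor 1 and once with factor ε(a_r). -/
theorem peak_cons (a : ℕ+) (l : List ℕ+) :
    peak (a :: l) = cons a (peak l) + sgn a • openPeak a l := rfl

theorem openPeak_cons (s a : ℕ+) (l : List ℕ+) : openPeak s (a :: l) =
    cons s (peak (a :: l)) + cons (s + a) (peak l) + sgn a • openPeak (s + a) l := rfl

/-! ### Evaluation at finite and at doubled alphabets. -/

section Evaluation

variable {D : Type*} [CommRing D]

/-- Evaluation of quasisymmetric functions at a finite list of variables. -/
def eval : List D → List ℕ+ → D
  | [] => unitCharacter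
  | x :: xs => zetaStep x (eval xs)

/-- Evaluation of quasisymmetric functions at the doubled alphabet. -/
def superEval : List D → List ℕ+ → D
  | [] => unitCharacter
  | x :: xs => sigmaStep x (zetaStep x (superEval xs))

theorem isCharacter_eval (xs : List D) : IsCharacter (eval xs) := by
  induction xs with
  | nil => exact isCharacter_unitCharacter
  | cons x xs ih => exact ih.zetaStep x

theorem isCharacter_superEval (xs : List D) : IsCharacter (superEval xs) := by
  induction xs with
  | nil => exact isCharacter_unitCharacter
  | cons x xs ih => exact (ih.zetaStep x).sigmaStep x

/-- The two convolution steps at one variable x give a prefix (a₁,…,a_r) the value x^(a₁+⋯+a_r)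
times the sum of ε(a₁)⋯ε(a_r) and ε(a₁)⋯ε(a_{r-1}). This is the weight of a block in `peak`,
evaluated at x. -/
theorem lift_eval_peak (xs : List D) (l : List ℕ+) : lift (eval xs) (peak l) = superEval xs l := by
  induction xs generalizing l with
  | nil =>
    have h : ∀ (l : List ℕ+) (s : ℕ+), lift (unitCharacter (D := D)) (openPeak s l) = 0 := by
      intro l
      induction l with
      | nil => intro s; rw [openPeak_nil, lift_of, unitCharacter]
      | cons a l ih =>
        intro s
        simp only [openPeak_cons, map_add, map_smul, lift_unitCharacter_cons, ih, smul_zero,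
          add_zero]
    rcases l with _ | ⟨a, l⟩
    · rw [peak_nil, lift_of]; rfl
    · rw [peak_cons]
      simp only [eval, superEval, map_add, map_smul, lift_unitCharacter_cons, h, smul_zero,
        add_zero, unitCharacter]
  | cons x xs ih =>
    -- Either x is not used, or x takes the open block: this contributes x^s, and x stays available
    -- for the parts of `l` that join the block.
    have h : ∀ (l : List ℕ+) (s : ℕ+), lift (eval (x :: xs)) (openPeak s l) =
        lift (eval xs) (openPeak s l) + x ^ (s : ℕ) * superEval (x :: xs) l := by
      intro l
      induction l with
      | nil =>
        intro s
        have h1 := (isCharacter_eval xs).map_nil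
        have h2 := (isCharacter_superEval (x :: xs)).map_nil
        rw [openPeak_nil, lift_of, lift_of, eval, zetaStep, h1, h2]
      | cons a l ihl =>
        intro s
        simp only [openPeak_cons, map_add, map_smul, ihl]
        simp only [eval, superEval, lift_zetaStep_cons, ih, sigmaStep, zetaStep, PNat.add_coe,
          pow_add, sgn, zsmul_eq_mul, neg_pow x]
        push_cast
        ring
    rcases l with _ | ⟨a, l⟩
    · rw [peak_nil, lift_of, (isCharacter_eval _).map_nil, (isCharacter_superEval _).map_nil]
    · have h3 := ih (a :: l)
      rw [peak_cons, map_add, map_smul] at h3 ⊢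
      rw [h]
      simp only [eval, superEval, lift_zetaStep_cons, ih, sigmaStep, zetaStep, sgn, zsmul_eq_mul,
        neg_pow x, ← h3]
      push_cast
      ring

end Evaluation

end QuasiShuffle

/-! ### Pseudo-compositions as exponents of monomials. -/

namespace PseudoComposition

/-- The pseudo-composition `(n, l₁, l₂, …)`. -/
def ofParts (n : ℕ) (l : List ℕ+) : PseudoComposition where
  head := n
  tail := l.map (↑)
  tail_pos := by
    intro x hx
    obtain ⟨a, _, rfl⟩ := List.mem_map.1 hx
    exact a.pos

theorem exists_ofParts (α : PseudoComposition) : ∃ n l, α = ofParts n l := by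
  refine ⟨α.head, α.tail.attach.map fun x => Nat.toPNat x.1 (α.tail_pos x.1 x.2), ?_⟩
  ext1
  · rfl
  · refine (List.attach_map_subtype_val α.tail).symm.trans ?_
    change _ = List.map PNat.val _
    rw [List.map_map]
    rfl

theorem ofParts_injective {n n' : ℕ} {l l' : List ℕ+} (h : ofParts n l = ofParts n' l') :
    n = n' ∧ l = l' :=
  ⟨congrArg head h, (List.map_injective_iff.2 PNat.coe_injective) (congrArg tail h)⟩

theorem exponent_zero {α : PseudoComposition} {i : Fin α.tail.length → ℕ} (hp : ∀ j, 0 < i j) :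
    α.exponent i 0 = α.head := by
  simp [exponent, (fun j => (hp j).ne' : ∀ j, i j ≠ 0)]

theorem exponent_apply {α : PseudoComposition} {i : Fin α.tail.length → ℕ} (hi : StrictMono i)
    (hp : ∀ j, 0 < i j) (j : Fin α.tail.length) : α.exponent i (i j) = α.tail.get j := by
  have h : (0 : ℕ) ≠ i j := (hp j).ne
  simp [exponent, Finsupp.single_apply, h, hi.injective.eq_iff]

theorem exponent_eq_zero {α : PseudoComposition} {i : Fin α.tail.length → ℕ} {x : ℕ}
    (hx : x ≠ 0) (h : ∀ j, i j ≠ x) : α.exponent i x = 0 := by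
  simp [exponent, h, hx.symm]

end PseudoComposition

section
open PseudoComposition QuasiShuffle

/-- The nonzero exponents of the variables `xs` in `d`, in the given order. -/
def values (xs : List ℕ) (d : ℕ →₀ ℕ) : List ℕ := (xs.filter fun x => d x ≠ 0).map d

/-- The variables in `xs` that occur are exactly the i_j, and two increasing lists with the same
members coincide. -/
theorem values_exponent {α : PseudoComposition} {i : Fin α.tail.length → ℕ} (hi : StrictMono i)
    (hp : ∀ j, 0 < i j) {xs : List ℕ} (hs : xs.SortedLT) (h0 : 0 ∉ xs) (hm : ∀ j, i j ∈ xs) :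
    values xs (α.exponent i) = α.tail := by
  have h : (xs.filter fun x => α.exponent i x ≠ 0) = List.ofFn i := by
    refine List.Pairwise.eq_of_mem_iff (r := (· < ·)) (hs.pairwise.filter _)
      (List.sortedLT_ofFn_iff.2 hi).pairwise fun x => ?_
    rw [List.mem_filter, List.mem_ofFn]
    constructor
    · rintro ⟨hx, hd⟩
      by_contra hc
      refine (of_decide_eq_true hd) (exponent_eq_zero (fun h => h0 (h ▸ hx)) fun j hj => hc ⟨j, hj⟩)
    · rintro ⟨j, rfl⟩
      exact ⟨hm j, decide_eq_true (α.pos_exponent i j).ne'⟩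
  rw [values, h, List.map_ofFn]
  have : (α.exponent i) ∘ i = α.tail.get := funext fun j => exponent_apply hi hp j
  rw [this, List.ofFn_get]

theorem exists_sorted_variables (d : ℕ →₀ ℕ) :
    ∃ xs : List ℕ, xs.SortedLT ∧ 0 ∉ xs ∧ ∀ x, x ≠ 0 → d x ≠ 0 → x ∈ xs := by
  refine ⟨(d.support.erase 0).sort, Finset.sortedLT_sort _, ?_, ?_⟩
  · simp
  · intro x hx hd
    simp [hx, hd]

/-! ### The monomial basis of BQSym. -/

namespace BQSym

theorem coeff_monomialSeries (α β : PseudoComposition) {i : Fin α.tail.length → ℕ}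
    (hi : StrictMono i) (hp : ∀ j, 0 < i j) [Decidable (α = β)] :
    MvPowerSeries.coeff (α.exponent i) (monomialSeries β) = if α = β then 1 else 0 := by
  classical
  change (if _ then _ else _) = _
  refine if_congr ⟨?_, ?_⟩ rfl rfl
  · rintro ⟨k, hk, hkp, h⟩
    obtain ⟨xs, hs, h0, hm⟩ := exists_sorted_variables (α.exponent i)
    ext1
    · rw [← exponent_zero hp, h, exponent_zero hkp]
    · rw [← values_exponent hi hp hs h0 fun j => hm _ (hp j).ne' (α.pos_exponent i j).ne', h,
        values_exponent hk hkp hs h0 fun j => hm _ (hkp j).ne' ?_]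
      rw [h]
      exact (β.pos_exponent k j).ne'
  · rintro rfl
    exact ⟨i, hi, hp, rfl⟩

/-- The exponent of x₀ and the other nonzero exponents, read in increasing order of variables,
recover the pseudo-composition of a monomial. The existential over index sequences thus becomes an
equality of lists. -/
theorem coeff_monomialSeries_eq_values {d : ℕ →₀ ℕ} {xs : List ℕ} (hs : xs.SortedLT)
    (h0 : 0 ∉ xs) (hm : ∀ x, x ≠ 0 → d x ≠ 0 → x ∈ xs) (β : PseudoComposition) :
    MvPowerSeries.coeff d (monomialSeries β) =
      if d 0 = β.head ∧ values xs d = β.tail then 1 else 0 := by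
  classical
  obtain ⟨α, i, hi, hp, rfl⟩ := exists_exponent_eq d
  rw [coeff_monomialSeries α β hi hp, exponent_zero hp,
    values_exponent hi hp hs h0 fun j => hm _ (hp j).ne' (α.pos_exponent i j).ne']
  simp only [PseudoComposition.ext_iff]

/-- The additive map taking the coefficient of the monomial with exponent `d`. -/
noncomputable def coeffHom (d : ℕ →₀ ℕ) : BQSym →ₗ[ℤ] ℤ :=
  (((MvPowerSeries.coeff (R := ℤ) d).toAddMonoidHom).comp
    BQSym.subtype.toAddMonoidHom).toIntLinearMap

theorem coeffHom_apply (d : ℕ →₀ ℕ) (f : BQSym) :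
    coeffHom d f = MvPowerSeries.coeff d (f : MvPowerSeries ℕ ℤ) := rfl

theorem ext_coeffHom {f g : BQSym} (h : ∀ d, coeffHom d f = coeffHom d g) : f = g :=
  Subtype.ext (MvPowerSeries.ext h)

theorem coeffHom_M (α β : PseudoComposition) {i : Fin α.tail.length → ℕ}
    (hi : StrictMono i) (hp : ∀ j, 0 < i j) [Decidable (α = β)] :
    coeffHom (α.exponent i) (M β) = if α = β then 1 else 0 :=
  coeff_monomialSeries α β hi hp

/-- The coefficient functional dual to `M α`. -/
noncomputable def dual (α : PseudoComposition) : BQSym →ₗ[ℤ] ℤ :=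
  coeffHom (α.exponent fun j => (j : ℕ) + 1)

theorem coeffHom_exponent (f : BQSym) (α : PseudoComposition) {i : Fin α.tail.length → ℕ}
    (hi : StrictMono i) (hp : ∀ j, 0 < i j) : coeffHom (α.exponent i) f = dual α f :=
  f.2.2 α i hi hp

theorem dual_M (α β : PseudoComposition) [Decidable (α = β)] :
    dual α (M β) = if α = β then 1 else 0 :=
  coeffHom_M α β (fun a b h => by simpa using h) fun j => Nat.succ_pos _

theorem linearIndependent_M : LinearIndependent ℤ M := by
  classical
  rw [linearIndependent_iff']
  intro s g h α hα
  have := congrArg (dual α) h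
  simpa only [map_sum, map_smul, dual_M, smul_eq_mul, mul_ite, mul_one, mul_zero,
    Finset.sum_ite_eq, hα, if_true, map_zero] using this

/-- Bounded degree leaves only pseudo-compositions of size at most N, of which there are finitely
many. -/
theorem exists_eq_sum_M (f : BQSym) : ∃ s : Finset PseudoComposition,
    f = ∑ α ∈ s, dual α f • M α := by
  classical
  obtain ⟨N, hN⟩ := f.2.1
  refine ⟨(Finset.range (N + 1)).biUnion ofSize, ext_coeffHom fun d => ?_⟩
  obtain ⟨α, i, hi, hp, rfl⟩ := exists_exponent_eq d
  simp only [map_sum, map_smul, coeffHom_M α _ hi hp, smul_eq_mul, mul_ite, mul_one, mul_zero,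
    Finset.sum_ite_eq]
  rw [coeffHom_exponent f α hi hp]
  split_ifs with h
  · rfl
  · by_contra hc
    rw [← coeffHom_exponent f α hi hp] at hc
    have := hN _ hc
    rw [degree_exponent] at this
    exact h (Finset.mem_biUnion.2 ⟨α.size, Finset.mem_range.2 (by omega), mem_ofSize.2 rfl⟩)

theorem span_M : ⊤ ≤ Submodule.span ℤ (Set.range M) := by
  intro f _
  obtain ⟨s, hs⟩ := exists_eq_sum_M f
  rw [hs]
  exact Submodule.sum_mem _ fun α _ => Submodule.smul_mem _ _ (Submodule.subset_span ⟨α, rfl⟩)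

/-- The variable `x_0`. -/
noncomputable def x₀ : BQSym := M (ofParts 1 [])

/-- The monomial quasisymmetric function not involving `x_0`. -/
noncomputable def mono (l : List ℕ+) : BQSym := M (ofParts 0 l)

/-- M_(1) is the variable x₀ itself; multiplying by it raises the exponent of x₀ and leaves the list
of the other exponents unchanged. This splits off x₀ as a polynomial variable. -/
theorem x₀_mul_M (n : ℕ) (l : List ℕ+) : x₀ * M (ofParts n l) = M (ofParts (n + 1) l) := by
  classical
  have hX : (x₀ : MvPowerSeries ℕ ℤ) = MvPowerSeries.X 0 := by
    ext d
    obtain ⟨xs, hs, h0, hm⟩ := exists_sorted_variables d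
    change MvPowerSeries.coeff d (monomialSeries _) = _
    rw [coeff_monomialSeries_eq_values hs h0 hm, MvPowerSeries.coeff_X]
    refine if_congr ⟨?_, ?_⟩ rfl rfl
    · rintro ⟨h1, h2⟩
      ext x
      by_cases hx : x = 0
      · subst hx; simpa [ofParts] using h1
      · rw [Finsupp.single_eq_of_ne hx]
        by_contra hd
        have h3 : values xs d = [] := h2
        rw [values, List.map_eq_nil_iff, List.filter_eq_nil_iff] at h3
        exact h3 x (hm x hx hd) (decide_eq_true hd)
    · rintro rfl
      refine ⟨by simp [ofParts], ?_⟩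
      change _ = []
      rw [values, List.map_eq_nil_iff, List.filter_eq_nil_iff]
      intro x hx
      have : x ≠ 0 := fun h => h0 (h ▸ hx)
      simp [Finsupp.single_eq_of_ne this]
  refine Subtype.ext (MvPowerSeries.ext fun d => ?_)
  obtain ⟨xs, hs, h0, hm⟩ := exists_sorted_variables d
  rw [Subring.coe_mul, hX, MvPowerSeries.X, MvPowerSeries.coeff_monomial_mul]
  change _ = MvPowerSeries.coeff d (monomialSeries _)
  rw [coeff_monomialSeries_eq_values hs h0 hm, one_mul]
  change (if _ then MvPowerSeries.coeff _ (monomialSeries _) else _) = _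
  have hd : ∀ x, x ≠ 0 → (d - Finsupp.single 0 1 : ℕ →₀ ℕ) x = d x := fun x hx => by
    simp [Finsupp.single_eq_of_ne hx]
  rw [coeff_monomialSeries_eq_values hs h0 (fun x hx h => hm x hx (by rwa [hd x hx] at h))]
  have hv : values xs (d - Finsupp.single 0 1) = values xs d := by
    have h1 : ∀ x ∈ xs, (d - Finsupp.single 0 1 : ℕ →₀ ℕ) x = d x := fun x hx => hd x fun h => h0 (h ▸ hx)
    rw [values, List.filter_congr (q := fun x => d x ≠ 0) (fun x hx => by rw [h1 x hx])]
    exact List.map_congr_left fun x hx => h1 x (List.mem_of_mem_filter hx)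
  rw [hv]
  have h1 : (d - Finsupp.single 0 1 : ℕ →₀ ℕ) 0 = d 0 - 1 := by simp
  rw [← ite_and, h1]
  refine if_congr ⟨?_, ?_⟩ rfl rfl
  · rintro ⟨h1, h2, h3⟩
    rw [Finsupp.single_le_iff] at h1
    change d 0 - 1 = n at h2
    refine ⟨?_, h3⟩
    change d 0 = n + 1
    omega
  · rintro ⟨h1, h2⟩
    change d 0 = n + 1 at h1
    rw [Finsupp.single_le_iff]
    refine ⟨by omega, ?_, h2⟩
    change d 0 - 1 = n
    omega

theorem M_ofParts (n : ℕ) (l : List ℕ+) : M (ofParts n l) = x₀ ^ n * mono l := by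
  induction n with
  | zero => rw [pow_zero, one_mul, mono]
  | succ n ih => rw [← x₀_mul_M, ih, pow_succ', mul_assoc]

theorem mono_nil : mono [] = 1 := by
  refine Subtype.ext (MvPowerSeries.ext fun d => ?_)
  classical
  obtain ⟨xs, hs, h0, hm⟩ := exists_sorted_variables d
  change MvPowerSeries.coeff d (monomialSeries _) = MvPowerSeries.coeff d 1
  rw [coeff_monomialSeries_eq_values hs h0 hm, MvPowerSeries.coeff_one]
  refine if_congr ⟨?_, ?_⟩ rfl rfl
  · rintro ⟨h1, h2⟩
    ext x
    by_cases hx : x = 0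
    · subst hx; exact h1
    · by_contra hd
      have h3 : values xs d = [] := h2
      rw [values, List.map_eq_nil_iff, List.filter_eq_nil_iff] at h3
      exact h3 x (hm x hx hd) (decide_eq_true hd)
  · rintro rfl
    refine ⟨rfl, ?_⟩
    change _ = []
    rw [values, List.map_eq_nil_iff, List.filter_eq_nil_iff]
    simp

end BQSym

/-! ### From finite alphabets to power series. -/

namespace PseudoComposition

theorem values_congr {xs : List ℕ} {d e : ℕ →₀ ℕ} (h : ∀ x ∈ xs, d x = e x) :
    values xs d = values xs e := by
  rw [values, List.filter_congr (q := fun x => e x ≠ 0) (fun x hx => by rw [h x hx])]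
  exact List.map_congr_left fun x hx => h x (List.mem_of_mem_filter hx)

theorem values_eq_nil_iff {xs : List ℕ} {d : ℕ →₀ ℕ} :
    ((∀ x, d x ≠ 0 → x ∈ xs) ∧ values xs d = []) ↔ d = 0 := by
  rw [values, List.map_eq_nil_iff, List.filter_eq_nil_iff]
  constructor
  · rintro ⟨h1, h2⟩
    ext x
    by_contra hx
    exact h2 x (h1 x hx) (decide_eq_true hx)
  · rintro rfl
    simp

/-- By induction on the alphabet: the two summands of `zetaStep` are separated by whether the first
variable occurs in d. Without repetitions in `xs`, at most one of them contributes. -/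
theorem coeff_eval {xs : List ℕ} (hxs : xs.Nodup) (l : List ℕ+) (d : ℕ →₀ ℕ)
    [Decidable ((∀ x, d x ≠ 0 → x ∈ xs) ∧ values xs d = l.map PNat.val)] :
    MvPowerSeries.coeff d (eval (xs.map (MvPowerSeries.X (R := ℤ))) l) =
      if (∀ x, d x ≠ 0 → x ∈ xs) ∧ values xs d = l.map PNat.val then 1 else 0 := by
  classical
  have hnil : ∀ (d : ℕ →₀ ℕ) (ys : List ℕ),
      MvPowerSeries.coeff d (eval (ys.map (MvPowerSeries.X (R := ℤ))) []) =
      if (∀ x, d x ≠ 0 → x ∈ ys) ∧ values ys d = [] then 1 else 0 := fun d ys => by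
    rw [(isCharacter_eval _).map_nil, MvPowerSeries.coeff_one]
    exact if_congr values_eq_nil_iff.symm rfl rfl
  induction xs generalizing l d with
  | nil =>
    rcases l with _ | ⟨a, l⟩
    · rw [hnil]; exact if_congr Iff.rfl rfl rfl
    · simp [eval, unitCharacter, values]
  | cons x xs ih =>
    rcases l with _ | ⟨a, l⟩
    · rw [hnil]; exact if_congr Iff.rfl rfl rfl
    obtain ⟨hx, hxs⟩ := List.nodup_cons.1 hxs
    rw [List.map_cons, eval, zetaStep, map_add, MvPowerSeries.X_pow_eq,
      MvPowerSeries.coeff_monomial_mul, one_mul, ih hxs, ih hxs]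
    have he : values xs (d - Finsupp.single x (a : ℕ)) = values xs d :=
      values_congr fun y hy => by
        have : y ≠ x := fun h => hx (h ▸ hy)
        simp [Finsupp.single_eq_of_ne this]
    have hle : Finsupp.single x (a : ℕ) ≤ d ↔ (a : ℕ) ≤ d x := Finsupp.single_le_iff
    have ha := a.pos
    rw [he]
    by_cases hd : d x = 0
    · have h1 : values (x :: xs) d = values xs d := by simp [values, hd]
      have h2 : (∀ y, d y ≠ 0 → y ∈ x :: xs) ↔ ∀ y, d y ≠ 0 → y ∈ xs := by
        refine forall_congr' fun y => ⟨fun h hy => ?_, fun h hy => List.mem_cons_of_mem _ (h hy)⟩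
        rcases List.mem_cons.1 (h hy) with rfl | h
        · exact absurd hd hy
        · exact h
      rw [if_neg (c := Finsupp.single x (a : ℕ) ≤ d) (fun h => by have := hle.1 h; omega),
        add_zero]
      exact if_congr (by rw [h1, h2]) rfl rfl
    · have h1 : values (x :: xs) d = d x :: values xs d := by simp [values, hd]
      rw [if_neg (fun h => hx (h.1 x hd)), zero_add, ← ite_and]
      refine if_congr ⟨?_, ?_⟩ rfl rfl
      · rintro ⟨h3, h4, h5⟩
        have h6 : d x = a := by
          by_contra hne
          refine hx (h4 x ?_)
          have := hle.1 h3
          simp only [Finsupp.coe_tsub, Pi.sub_apply, Finsupp.single_eq_same]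
          omega
        refine ⟨fun y hy => ?_, by rw [h1, h6, h5, List.map_cons]⟩
        by_cases hyx : y = x
        · simp [hyx]
        · refine List.mem_cons_of_mem _ (h4 y ?_)
          simpa [Finsupp.single_eq_of_ne hyx] using hy
      · rintro ⟨h3, h4⟩
        rw [h1, List.map_cons] at h4
        obtain ⟨h5, h6⟩ := List.cons.inj h4
        refine ⟨hle.2 h5.ge, fun y hy => ?_, h6⟩
        by_cases hyx : y = x
        · subst hyx
          simp [h5] at hy
        · have : d y ≠ 0 := by simpa [Finsupp.single_eq_of_ne hyx] using hy
          exact (List.mem_cons.1 (h3 y this)).resolve_left hyx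

end PseudoComposition

namespace BQSym

/-- The embedding of `Words` into `BQSym`, with image the quasisymmetric functions not
involving `x_0`. -/
noncomputable def ofWords : Words →ₗ[ℤ] BQSym := Finsupp.linearCombination ℤ mono

@[simp]
theorem ofWords_of (l : List ℕ+) : ofWords (of l) = mono l := by simp [ofWords]

/-- A single monomial involves finitely many variables, so its coefficient is already visible in a
finite alphabet. If x₀ occurs in it, both sides vanish. -/
theorem coeff_ofWords {xs : List ℕ} (hs : xs.SortedLT) (h0 : 0 ∉ xs) {d : ℕ →₀ ℕ}
    (hm : ∀ x, x ≠ 0 → d x ≠ 0 → x ∈ xs) (f : Words) :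
    MvPowerSeries.coeff d (ofWords f : MvPowerSeries ℕ ℤ) =
      MvPowerSeries.coeff d (lift (eval (xs.map (MvPowerSeries.X (R := ℤ)))) f) := by
  classical
  have : coeffHom d ∘ₗ ofWords = (MvPowerSeries.coeff (R := ℤ) d).toAddMonoidHom.toIntLinearMap ∘ₗ
      lift (eval (xs.map (MvPowerSeries.X (R := ℤ)))) := by
    refine words_hom_ext fun l => ?_
    rw [LinearMap.comp_apply, LinearMap.comp_apply, ofWords_of, lift_of, coeffHom_apply]
    change MvPowerSeries.coeff d (monomialSeries _) = MvPowerSeries.coeff d _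
    rw [coeff_eval hs.nodup, coeff_monomialSeries_eq_values hs h0 hm]
    refine if_congr (and_congr_left' ⟨fun h x hx => hm x ?_ hx, fun h => ?_⟩) rfl rfl
    · rintro rfl
      exact hx h
    · by_contra hd
      exact h0 (h 0 hd)
  exact DFunLike.congr_fun this f

/-- The transfer principle: multiplicative identities in `BQSym` follow from identities on all
finite alphabets. -/
theorem ofWords_mul_ofWords {f g h : Words}
    (H : ∀ xs : List (MvPowerSeries ℕ ℤ),
      lift (eval xs) f * lift (eval xs) g = lift (eval xs) h) :
    ofWords f * ofWords g = ofWords h := by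
  classical
  refine Subtype.ext (MvPowerSeries.ext fun d => ?_)
  obtain ⟨xs, hs, h0, hm⟩ := exists_sorted_variables d
  rw [Subring.coe_mul, coeff_ofWords hs h0 hm, ← H, MvPowerSeries.coeff_mul,
    MvPowerSeries.coeff_mul]
  refine Finset.sum_congr rfl fun p hp => ?_
  rw [Finset.HasAntidiagonal.mem_antidiagonal] at hp
  -- The alphabet chosen for d also serves both summands of any decomposition of d.
  rw [coeff_ofWords hs h0 (fun x hx h => hm x hx ?_), coeff_ofWords hs h0 (fun x hx h => hm x hx ?_)]
  all_goals
    rw [← hp, Finsupp.add_apply]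
    omega

theorem mono_mul_mono (l k : List ℕ+) : mono l * mono k = ofWords (prod l k) := by
  rw [← ofWords_of, ← ofWords_of]
  refine ofWords_mul_ofWords fun xs => ?_
  rw [lift_of, lift_of, (isCharacter_eval xs).map_prod]

/-- The linear extension of the peak map. -/
noncomputable def peakWords : Words →ₗ[ℤ] Words := Finsupp.linearCombination ℤ peak

/-- On each finite alphabet, the peak map followed by evaluation is `superEval`, which is a
character. -/
theorem ofWords_peak_mul (l k : List ℕ+) :
    ofWords (peak l) * ofWords (peak k) = ofWords (peakWords (prod l k)) := by
  refine ofWords_mul_ofWords fun xs => ?_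
  have : lift (eval xs) ∘ₗ peakWords = lift (superEval xs) := words_hom_ext fun l => by
    rw [LinearMap.comp_apply, lift_of, peakWords, Finsupp.linearCombination_single, one_smul,
      lift_eval_peak]
  rw [lift_eval_peak, lift_eval_peak, ← (isCharacter_superEval xs).map_prod, ← this,
    LinearMap.comp_apply]

/-! ### Maps out of BQSym defined on the basis. -/

/-- The basis `x₀ ^ n * mono l = M (n, l)` of `BQSym`. -/
noncomputable def basis : Module.Basis (ℕ × List ℕ+) ℤ BQSym :=
  Module.Basis.mk (v := fun p => x₀ ^ p.1 * mono p.2)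
    (by
      have := linearIndependent_M.comp (fun p : ℕ × List ℕ+ => ofParts p.1 p.2)
        fun p q h => Prod.ext (ofParts_injective h).1 (ofParts_injective h).2
      convert this using 1
      exact funext fun p => (M_ofParts _ _).symm)
    (by
      refine span_M.trans (Submodule.span_mono ?_)
      rintro _ ⟨α, rfl⟩
      obtain ⟨n, l, rfl⟩ := α.exists_ofParts
      exact ⟨(n, l), (M_ofParts _ _).symm⟩)

theorem basis_apply (n : ℕ) (l : List ℕ+) : basis (n, l) = x₀ ^ n * mono l := by
  simp [basis]

theorem mono_induction {p : BQSym → Prop} (f : BQSym) (basis : ∀ n l, p (x₀ ^ n * mono l))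
    (zero : p 0) (add : ∀ f g, p f → p g → p (f + g)) (smul : ∀ (c : ℤ) f, p f → p (c • f)) :
    p f := by
  have hf : f ∈ Submodule.span ℤ (Set.range M) := span_M Submodule.mem_top
  induction hf using Submodule.span_induction with
  | mem x hx =>
    obtain ⟨α, rfl⟩ := hx
    obtain ⟨n, l, rfl⟩ := α.exists_ofParts
    rw [M_ofParts]
    exact basis n l
  | zero => exact zero
  | add f g _ _ hf hg => exact add f g hf hg
  | smul c f _ hf => exact smul c f hf

/-- The additive map with `x₀ ^ n * mono l ↦ y ^ n * u l`. -/
noncomputable def addLift {D : Type*} [CommRing D] (y : D) (u : List ℕ+ → D) : BQSym →+ D :=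
  (basis.constr ℤ fun p => y ^ p.1 * u p.2).toAddMonoidHom

theorem addLift_apply {D : Type*} [CommRing D] (y : D) (u : List ℕ+ → D) (n : ℕ) (l : List ℕ+) :
    addLift y u (x₀ ^ n * mono l) = y ^ n * u l := by
  rw [← basis_apply]
  exact basis.constr_basis ℤ _ _

theorem addLift_mono {D : Type*} [CommRing D] (y : D) (u : List ℕ+ → D) (l : List ℕ+) :
    addLift y u (mono l) = u l := by
  simpa using addLift_apply y u 0 l

theorem addLift_x₀_pow_mul {D : Type*} [CommRing D] (y : D) (u : List ℕ+ → D) (n : ℕ)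
    (f : BQSym) : addLift y u (x₀ ^ n * f) = y ^ n * addLift y u f := by
  induction f using mono_induction with
  | basis m l => rw [← mul_assoc, ← pow_add, addLift_apply, addLift_apply, pow_add, mul_assoc]
  | zero => simp only [mul_zero, map_zero]
  | add f g hf hg => simp only [mul_add, map_add, hf, hg]
  | smul c f hf => simp only [mul_smul_comm, map_zsmul, hf]

theorem addLift_mul {D : Type*} [CommRing D] {y : D} {u : List ℕ+ → D}
    (h : ∀ l k, addLift y u (mono l * mono k) = u l * u k) (f g : BQSym) :
    addLift y u (f * g) = addLift y u f * addLift y u g := by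
  induction f using mono_induction with
  | basis n l =>
    induction g using mono_induction with
    | basis m k =>
      rw [mul_mul_mul_comm, ← pow_add, addLift_x₀_pow_mul, h, pow_add, mul_mul_mul_comm,
        addLift_apply, addLift_apply]
    | zero => simp only [mul_zero, map_zero]
    | add f g hf hg => simp only [mul_add, map_add, hf, hg]
    | smul c f hf => simp only [mul_smul_comm, map_zsmul, hf]
  | zero => simp only [zero_mul, map_zero]
  | add f g hf hg => simp only [add_mul, map_add, hf, hg]
  | smul c f hf => simp only [smul_mul_assoc, map_zsmul, hf]

/-- The ring homomorphism with `x₀ ↦ y` and `mono l ↦ u l`. -/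
noncomputable def ringLift {D : Type*} [CommRing D] (y : D) (u : List ℕ+ → D)
    (h1 : u [] = 1) (h : ∀ l k, addLift y u (mono l * mono k) = u l * u k) : BQSym →+* D :=
  { addLift y u with
    map_one' := by
      change addLift y u 1 = 1
      rw [← mono_nil, addLift_mono, h1]
    map_mul' := addLift_mul h }

/-- The algebra homomorphism with `x₀ ↦ y` and `mono l ↦ u l`. -/
noncomputable def algLift {D : Type*} [CommRing D] [Algebra ℤ D] (y : D) (u : List ℕ+ → D)
    (h1 : u [] = 1) (h : ∀ l k, addLift y u (mono l * mono k) = u l * u k) : BQSym →ₐ[ℤ] D :=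
  { ringLift y u h1 h with
    commutes' := fun n => by
      change ringLift y u h1 h (algebraMap ℤ BQSym n) = algebraMap ℤ D n
      rw [eq_intCast, eq_intCast, map_intCast] }

theorem algLift_apply {D : Type*} [CommRing D] [Algebra ℤ D] (y : D) (u : List ℕ+ → D)
    (h1 : u [] = 1) (h : ∀ l k, addLift y u (mono l * mono k) = u l * u k) (f : BQSym) :
    algLift y u h1 h f = addLift y u f := rfl

theorem algHom_ext {D : Type*} [Semiring D] [Algebra ℤ D] {f g : BQSym →ₐ[ℤ] D}
    (h0 : f x₀ = g x₀) (h : ∀ l, f (mono l) = g (mono l)) : f = g := by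
  ext x
  induction x using mono_induction with
  | basis n l => simp only [map_mul, map_pow, h0, h]
  | zero => simp only [map_zero]
  | add x y hx hy => simp only [map_add, hx, hy]
  | smul c x hx => rw [map_smul, map_smul, hx]

end BQSym

/-! ### The bialgebra structure. -/

namespace BQSym

section Bialgebra

attribute [local instance 2000] TensorProduct.instModule Algebra.TensorProduct.leftAlgebra

/-- Prepending the part `a` after the first part, on the basis of monomial functions. -/
noncomputable def consPart (a : ℕ+) : BQSym →ₗ[ℤ] BQSym :=
  (addLift x₀ fun l => mono (a :: l)).toIntLinearMap

theorem consPart_mono (a : ℕ+) (l : List ℕ+) : consPart a (mono l) = mono (a :: l) := by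
  rw [consPart, AddMonoidHom.coe_toIntLinearMap, addLift_mono]

theorem consPart_ofWords (a : ℕ+) (f : Words) : consPart a (ofWords f) = ofWords (cons a f) := by
  have : consPart a ∘ₗ ofWords = ofWords ∘ₗ cons a := words_hom_ext fun l => by
    simp only [LinearMap.comp_apply, ofWords_of, consPart_mono, cons_of]
  exact DFunLike.congr_fun this f

theorem consPart_x₀_pow_mul (a : ℕ+) (n : ℕ) (f : BQSym) :
    consPart a (x₀ ^ n * f) = x₀ ^ n * consPart a f := by
  rw [consPart, AddMonoidHom.coe_toIntLinearMap, addLift_x₀_pow_mul]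

theorem mono_cons_mul_mono_cons (a b : ℕ+) (l k : List ℕ+) : mono (a :: l) * mono (b :: k) =
    consPart a (mono l * mono (b :: k)) + consPart b (mono (a :: l) * mono k) +
      consPart (a + b) (mono l * mono k) := by
  simp only [mono_mul_mono, prod_cons_cons, map_add, consPart_ofWords]

/-- The quasi-shuffle recursion, extended linearly over powers of x₀. In this operator form it
passes to tensor products. -/
theorem consPart_mul_consPart (a b : ℕ+) (f g : BQSym) : consPart a f * consPart b g =
    consPart a (f * consPart b g) + consPart b (consPart a f * g) + consPart (a + b) (f * g) := by
  induction f using mono_induction with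
  | basis n l =>
    induction g using mono_induction with
    | basis m k =>
      have h : ∀ p q, x₀ ^ n * p * (x₀ ^ m * q) = x₀ ^ (n + m) * (p * q) := fun p q => by
        rw [mul_mul_mul_comm, ← pow_add]
      simp only [consPart_x₀_pow_mul, consPart_mono, h, mono_cons_mul_mono_cons, mul_add]
    | zero => simp only [mul_zero, map_zero, add_zero]
    | add f g hf hg => simp only [mul_add, map_add, hf, hg]; abel
    | smul c f hf => simp only [mul_smul_comm, map_zsmul, hf, smul_add]
  | zero => simp only [zero_mul, map_zero, add_zero]
  | add f g hf hg => simp only [add_mul, map_add, hf, hg]; abel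
  | smul c f hf => simp only [smul_mul_assoc, map_zsmul, hf, smul_add]

/-- Prepending a part in the first tensor factor. -/
noncomputable def consLeft (a : ℕ+) (E : Type*) [AddCommMonoid E] [Module ℤ E] :
    BQSym ⊗[ℤ] E →ₗ[ℤ] BQSym ⊗[ℤ] E :=
  (consPart a).rTensor E

theorem consLeft_tmul (a : ℕ+) {E : Type*} [AddCommMonoid E] [Module ℤ E] (f : BQSym) (x : E) :
    consLeft a E (f ⊗ₜ x) = consPart a f ⊗ₜ x := rfl

theorem consLeft_mul_consLeft (a b : ℕ+) (X Y : BQSym ⊗[ℤ] BQSym) :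
    consLeft a BQSym X * consLeft b BQSym Y =
      consLeft a BQSym (X * consLeft b BQSym Y) + consLeft b BQSym (consLeft a BQSym X * Y) +
        consLeft (a + b) BQSym (X * Y) := by
  induction X with
  | zero => simp only [map_zero, zero_mul, add_zero]
  | add X X' h h' => simp only [map_add, add_mul, h, h']; abel
  | tmul f f' =>
    induction Y with
    | zero => simp only [map_zero, mul_zero, add_zero]
    | add Y Y' h h' => simp only [map_add, mul_add, h, h']; abel
    | tmul g g' =>
      simp only [consLeft_tmul, Algebra.TensorProduct.tmul_mul_tmul,
        consPart_mul_consPart, TensorProduct.add_tmul]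

theorem consLeft_mul_one_tmul (a : ℕ+) (X : BQSym ⊗[ℤ] BQSym) (h : BQSym) :
    consLeft a BQSym (X * 1 ⊗ₜ h) = consLeft a BQSym X * 1 ⊗ₜ h := by
  induction X with
  | zero => simp only [map_zero, zero_mul]
  | add X X' h h' => simp only [map_add, add_mul, h, h']
  | tmul f f' =>
    simp only [consLeft_tmul, Algebra.TensorProduct.tmul_mul_tmul, mul_one]

/-- The deconcatenation coproduct of `mono l`. -/
noncomputable def deconcat : List ℕ+ → BQSym ⊗[ℤ] BQSym
  | [] => 1
  | a :: l => 1 ⊗ₜ mono (a :: l) + consLeft a BQSym (deconcat l)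

theorem deconcat_eq_sum (l : List ℕ+) : deconcat l =
    ∑ j ∈ Finset.range (l.length + 1), mono (l.take j) ⊗ₜ[ℤ] mono (l.drop j) := by
  induction l with
  | nil => simp [deconcat, mono_nil, Algebra.TensorProduct.one_def]
  | cons a l ih =>
    rw [List.length_cons, Finset.sum_range_succ', deconcat, ih, map_sum, add_comm]
    simp only [consLeft_tmul, consPart_mono, List.take_succ_cons, List.drop_succ_cons,
      List.take_zero, List.drop_zero, mono_nil]

theorem deconcat_cons_eq_sum (a : ℕ+) (l : List ℕ+) : deconcat (a :: l) = 1 ⊗ₜ mono (a :: l) +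
    ∑ j ∈ Finset.range (l.length + 1), mono (a :: l.take j) ⊗ₜ[ℤ] mono (l.drop j) := by
  rw [deconcat, deconcat_eq_sum, map_sum]
  simp only [consLeft_tmul, consPart_mono]

/-- `x_0 ⊗ 1 + 1 ⊗ x_0`. -/
noncomputable def x₀₀ : BQSym ⊗[ℤ] BQSym := x₀ ⊗ₜ 1 + 1 ⊗ₜ x₀

theorem addLift_deconcat_ofWords_cons (a : ℕ+) (f : Words) :
    addLift x₀₀ deconcat (ofWords (cons a f)) =
      1 ⊗ₜ ofWords (cons a f) + consLeft a BQSym (addLift x₀₀ deconcat (ofWords f)) := by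
  induction f using Finsupp.induction_linear with
  | zero => simp only [map_zero, TensorProduct.tmul_zero, add_zero]
  | add f g hf hg => simp only [map_add, hf, hg, TensorProduct.tmul_add]; abel
  | single l c =>
    have : Finsupp.single l c = c • of l := by simp
    rw [this]
    simp only [map_zsmul, cons_of, ofWords_of, addLift_mono, deconcat, smul_add]
    rw [TensorProduct.tmul_smul]

/-- Each factor is "cut before the first part" plus "cut later". The product of the first kinds is
the quasi-shuffle in the right tensor factor (`h3`), the product of the second kinds is the
recursion for `consLeft` (`h4`), and the mixed products come from `h5` and `h6`. -/
theorem addLift_deconcat_mono_mul (l k : List ℕ+) :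
    addLift x₀₀ deconcat (mono l * mono k) = deconcat l * deconcat k := by
  induction l generalizing k with
  | nil => rw [mono_nil, one_mul, addLift_mono, deconcat, one_mul]
  | cons a l ihl =>
    induction k with
    | nil => rw [mono_nil, mul_one, addLift_mono, deconcat.eq_1, mul_one]
    | cons b k ihk =>
      have h1 := ihl (b :: k)
      have h2 := ihl k
      rw [mono_mul_mono] at h1 h2 ihk
      have h3 : (1 : BQSym) ⊗ₜ[ℤ] mono (a :: l) * 1 ⊗ₜ mono (b :: k) =
          1 ⊗ₜ (mono (a :: l) * mono (b :: k)) := by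
        rw [Algebra.TensorProduct.tmul_mul_tmul, one_mul]
      have h4 := consLeft_mul_consLeft a b (deconcat l) (deconcat k)
      have h5 := consLeft_mul_one_tmul a (deconcat l) (mono (b :: k))
      have h6 := consLeft_mul_one_tmul b (deconcat k) (mono (a :: l))
      rw [mono_mul_mono, prod_cons_cons, map_add, map_add, TensorProduct.tmul_add,
        TensorProduct.tmul_add] at h3
      rw [mono_mul_mono, prod_cons_cons, map_add, map_add, map_add, map_add,
        addLift_deconcat_ofWords_cons, addLift_deconcat_ofWords_cons,
        addLift_deconcat_ofWords_cons, h1, h2, ihk, deconcat, deconcat, mul_add, add_mul,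
        map_add, map_add, h5, mul_comm (1 ⊗ₜ[ℤ] mono (a :: l)) (deconcat k), h6]
      linear_combination -h3 - h4

/-- The coproduct of `BQSym`. -/
noncomputable def comulHom : BQSym →ₐ[ℤ] BQSym ⊗[ℤ] BQSym :=
  algLift x₀₀ deconcat (by rw [deconcat]) addLift_deconcat_mono_mul

theorem comulHom_apply (f : BQSym) : comulHom f = addLift x₀₀ deconcat f := algLift_apply _ _ _ _ _

theorem comulHom_x₀_pow_mul_mono (n : ℕ) (l : List ℕ+) :
    comulHom (x₀ ^ n * mono l) = x₀₀ ^ n * deconcat l := by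
  rw [comulHom_apply, addLift_apply]

theorem comulHom_mono (l : List ℕ+) : comulHom (mono l) = deconcat l := by
  rw [comulHom_apply, addLift_mono]

theorem comulHom_x₀ : comulHom x₀ = x₀ ⊗ₜ 1 + 1 ⊗ₜ x₀ := by
  have := comulHom_x₀_pow_mul_mono 1 []
  rwa [mono_nil, mul_one, pow_one, deconcat, mul_one, pow_one] at this

/-- The counit of `BQSym`: the constant term. -/
noncomputable def counitHom : BQSym →ₐ[ℤ] ℤ :=
  ((MvPowerSeries.constantCoeff (σ := ℕ) (R := ℤ)).comp BQSym.subtype).toIntAlgHom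

theorem counitHom_M (α : PseudoComposition) [Decidable (ofParts 0 [] = α)] :
    counitHom (M α) = if ofParts 0 [] = α then 1 else 0 := by
  -- The constant term is the coefficient at the pseudo-composition (0). Its index sequence is
  -- empty, so the value 1 is a dummy.
  have := coeffHom_M (ofParts 0 []) α (i := fun _ => 1) (fun i => i.elim0) (fun i => i.elim0)
  rw [← this]
  have h : (ofParts 0 []).exponent (fun _ => 1) = 0 := by
    exact (congrArg₂ (· + ·) (Finsupp.single_zero 0) (Fin.sum_univ_zero _)).trans (add_zero 0)
  rw [h]
  rfl

theorem counitHom_x₀ : counitHom x₀ = 0 := by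
  classical
  rw [x₀, counitHom_M, if_neg]
  exact fun h => absurd (ofParts_injective h).1 (by simp)

theorem counitHom_mono_cons (a : ℕ+) (l : List ℕ+) : counitHom (mono (a :: l)) = 0 := by
  classical
  rw [mono, counitHom_M, if_neg]
  exact fun h => absurd (ofParts_injective h).2 (by simp)

theorem assoc_consLeft_tmul (a : ℕ+) (Z : BQSym ⊗[ℤ] BQSym) (g : BQSym) :
    TensorProduct.assoc ℤ BQSym BQSym BQSym (consLeft a BQSym Z ⊗ₜ g) =
      consLeft a (BQSym ⊗[ℤ] BQSym) (TensorProduct.assoc ℤ BQSym BQSym BQSym (Z ⊗ₜ g)) := by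
  induction Z with
  | zero => simp only [map_zero, TensorProduct.zero_tmul]
  | add X Y hX hY => simp only [map_add, TensorProduct.add_tmul, hX, hY]
  | tmul f f' => simp only [consLeft_tmul, TensorProduct.assoc_tmul]

/-- Prepending a part to the first of three tensor factors turns the statement for l into the one
for a :: l, apart from the terms whose first factor is 1; these agree on both sides. -/
theorem deconcat_coassoc (l : List ℕ+) :
    TensorProduct.assoc ℤ BQSym BQSym BQSym (comulHom.toLinearMap.rTensor BQSym (deconcat l)) =
      comulHom.toLinearMap.lTensor BQSym (deconcat l) := by
  induction l with
  | nil =>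
    simp only [deconcat, Algebra.TensorProduct.one_def, LinearMap.rTensor_tmul,
      LinearMap.lTensor_tmul, AlgHom.toLinearMap_apply, map_one, TensorProduct.assoc_tmul]
  | cons a l ih =>
    have h := congrArg (consLeft a (BQSym ⊗[ℤ] BQSym)) ih
    rw [deconcat_eq_sum] at h
    rw [deconcat_cons_eq_sum]
    simp only [map_add, map_sum, LinearMap.rTensor_tmul, LinearMap.lTensor_tmul,
      AlgHom.toLinearMap_apply, comulHom_mono, map_one, Algebra.TensorProduct.one_def,
      TensorProduct.assoc_tmul, deconcat, TensorProduct.add_tmul, TensorProduct.tmul_add,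
      assoc_consLeft_tmul, Finset.sum_add_distrib, consLeft_tmul, consPart_mono] at h ⊢
    rw [h, deconcat_eq_sum, map_sum]
    simp only [consLeft_tmul, consPart_mono, TensorProduct.tmul_sum]
    abel

theorem deconcat_rTensor_counit (l : List ℕ+) :
    counitHom.toLinearMap.rTensor BQSym (deconcat l) = 1 ⊗ₜ mono l := by
  cases l with
  | nil =>
    simp only [deconcat, Algebra.TensorProduct.one_def, LinearMap.rTensor_tmul,
      AlgHom.toLinearMap_apply, map_one, mono_nil]
  | cons a l =>
    simp only [deconcat_cons_eq_sum, map_add, map_sum, LinearMap.rTensor_tmul,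
      AlgHom.toLinearMap_apply, map_one, counitHom_mono_cons, TensorProduct.zero_tmul,
      Finset.sum_const_zero, add_zero]

theorem deconcat_lTensor_counit (l : List ℕ+) :
    counitHom.toLinearMap.lTensor BQSym (deconcat l) = mono l ⊗ₜ 1 := by
  induction l with
  | nil =>
    simp only [deconcat, Algebra.TensorProduct.one_def, LinearMap.lTensor_tmul,
      AlgHom.toLinearMap_apply, map_one, mono_nil]
  | cons a l ih =>
    rw [deconcat, map_add, LinearMap.lTensor_tmul, AlgHom.toLinearMap_apply, counitHom_mono_cons,
      TensorProduct.tmul_zero, zero_add, consLeft, ← LinearMap.comp_apply, LinearMap.lTensor_comp_rTensor,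
      ← LinearMap.rTensor_comp_lTensor, LinearMap.comp_apply, ih, LinearMap.rTensor_tmul,
      consPart_mono]

/-- The bialgebra structure of `BQSym`. -/
@[reducible]
noncomputable def bialgebra : Bialgebra ℤ BQSym :=
  Bialgebra.ofAlgHom comulHom counitHom
    (algHom_ext
      (by
        simp only [AlgHom.comp_apply, comulHom_x₀, map_add, Algebra.TensorProduct.map_tmul,
          AlgHom.id_apply, map_one, TensorProduct.add_tmul, TensorProduct.tmul_add,
          Algebra.TensorProduct.one_def, AlgEquiv.toAlgHom_apply,
          Algebra.TensorProduct.assoc_tmul]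
        abel)
      (fun l => by
        simp only [AlgHom.comp_apply, comulHom_mono]
        exact deconcat_coassoc l))
    (algHom_ext
      (by
        simp only [AlgHom.comp_apply, comulHom_x₀, map_add, Algebra.TensorProduct.map_tmul,
          AlgHom.id_apply, map_one, counitHom_x₀, TensorProduct.zero_tmul, zero_add]
        rfl)
      (fun l => by
        simp only [AlgHom.comp_apply, comulHom_mono]
        exact deconcat_rTensor_counit l))
    (algHom_ext
      (by
        simp only [AlgHom.comp_apply, comulHom_x₀, map_add, Algebra.TensorProduct.map_tmul,
          AlgHom.id_apply, map_one, counitHom_x₀, TensorProduct.tmul_zero, add_zero]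
        rfl)
      (fun l => by
        simp only [AlgHom.comp_apply, comulHom_mono]
        exact deconcat_lTensor_counit l))

section
attribute [local instance] bialgebra

theorem comul_eq_comulHom (f : BQSym) : Coalgebra.comul (R := ℤ) f = comulHom f := rfl

/-- The binomial coefficients come from expanding the n-th power of x₀ ⊗ 1 + 1 ⊗ x₀, whose two
summands commute. -/
theorem hasStandardCoalgebra : HasStandardCoalgebra := by
  refine ⟨fun f => rfl, fun n α hα => ?_⟩
  obtain ⟨n', l, h⟩ := exists_ofParts ⟨n, α, hα⟩
  obtain rfl : n = n' := congrArg head h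
  obtain rfl : α = l.map PNat.val := congrArg tail h
  have h1 : M ⟨n, l.map PNat.val, hα⟩ = x₀ ^ n * mono l := M_ofParts n l
  rw [h1, comul_eq_comulHom, comulHom_x₀_pow_mul_mono, deconcat_eq_sum, Finset.mul_sum, x₀₀, add_pow,
    List.length_map]
  refine Finset.sum_congr rfl fun j _ => ?_
  rw [Finset.sum_mul]
  refine Finset.sum_congr rfl fun i _ => ?_
  have h2 : ∀ m h, M ⟨m, (l.map PNat.val).take j, h⟩ = x₀ ^ m * mono (l.take j) := fun m h => by
    rw [← M_ofParts]
    congr 1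
    exact PseudoComposition.ext rfl List.map_take.symm
  have h3 : ∀ m h, M ⟨m, (l.map PNat.val).drop j, h⟩ = x₀ ^ m * mono (l.drop j) := fun m h => by
    rw [← M_ofParts]
    congr 1
    exact PseudoComposition.ext rfl List.map_drop.symm
  rw [h2, h3, Algebra.TensorProduct.tmul_pow, Algebra.TensorProduct.tmul_pow, one_pow, one_pow,
    Algebra.TensorProduct.tmul_mul_tmul, one_mul, mul_one, nsmul_eq_mul, mul_comm _ (Nat.cast _),
    mul_assoc, Algebra.TensorProduct.tmul_mul_tmul]

end

end Bialgebra

end BQSym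

namespace BQSym

/-! ### The antipode. -/

section Antipode

attribute [local instance 2000] TensorProduct.instModule Algebra.TensorProduct.leftAlgebra
attribute [local instance] bialgebra

/-- The left convolution inverse of `mono`. -/
noncomputable def leftInverse (l : List ℕ+) : BQSym :=
  if l = [] then 1 else -∑ j : Fin l.length, leftInverse (l.take j) * mono (l.drop j)
termination_by l.length
decreasing_by simp

/-- The right convolution inverse of `mono`. -/
noncomputable def rightInverse (l : List ℕ+) : BQSym :=
  if l = [] then 1 else
    -∑ j : Fin l.length, mono (l.take (j + 1)) * rightInverse (l.drop (j + 1))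
termination_by l.length
decreasing_by
  rw [List.length_drop]
  exact Nat.sub_lt (Fin.pos ‹_›) (Nat.succ_pos _)

theorem leftInverse_nil : leftInverse [] = 1 := by rw [leftInverse, if_pos rfl]

theorem rightInverse_nil : rightInverse [] = 1 := by rw [rightInverse, if_pos rfl]

theorem sum_leftInverse_mul (a : ℕ+) (l : List ℕ+) :
    ∑ j ∈ Finset.range ((a :: l).length + 1),
      leftInverse ((a :: l).take j) * mono ((a :: l).drop j) = 0 := by
  rw [Finset.sum_range_succ, List.take_length, List.drop_length, mono_nil, mul_one,
    leftInverse.eq_1 (a :: l), if_neg (by simp), Finset.sum_range, add_neg_cancel]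

theorem sum_mul_rightInverse (a : ℕ+) (l : List ℕ+) :
    ∑ j ∈ Finset.range ((a :: l).length + 1),
      mono ((a :: l).take j) * rightInverse ((a :: l).drop j) = 0 := by
  rw [Finset.sum_range_succ', List.take_zero, List.drop_zero, mono_nil, one_mul,
    rightInverse.eq_1 (a :: l), if_neg (by simp), Finset.sum_range, add_neg_cancel]

/-- The two summands of `x₀₀` contribute c and -c times the same product. With c = -x₀ or c = x₀
this serves both one-sided inverses. -/
theorem mul_map_x₀₀_mul {S T : BQSym →ₗ[ℤ] BQSym} {c : BQSym} (hS : ∀ f, S (x₀ * f) = c * S f)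
    (hT : ∀ f, T (x₀ * f) = -(c * T f)) (t : BQSym ⊗[ℤ] BQSym) :
    LinearMap.mul' ℤ BQSym (TensorProduct.map S T (x₀₀ * t)) = 0 := by
  induction t with
  | zero => rw [mul_zero, map_zero, map_zero]
  | add x y hx hy => rw [mul_add, map_add, map_add, hx, hy, add_zero]
  | tmul f g =>
    rw [x₀₀, add_mul, Algebra.TensorProduct.tmul_mul_tmul, Algebra.TensorProduct.tmul_mul_tmul,
      one_mul, one_mul, map_add, map_add, TensorProduct.map_tmul, TensorProduct.map_tmul,
      LinearMap.mul'_apply, LinearMap.mul'_apply, hS, hT]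
    ring

theorem mul_map_comul {S T : BQSym →ₗ[ℤ] BQSym} {c : BQSym} (hS : ∀ f, S (x₀ * f) = c * S f)
    (hT : ∀ f, T (x₀ * f) = -(c * T f)) (h1 : S 1 * T 1 = 1)
    (h : ∀ (a : ℕ+) l, ∑ j ∈ Finset.range ((a :: l).length + 1),
      S (mono ((a :: l).take j)) * T (mono ((a :: l).drop j)) = 0) (f : BQSym) :
    LinearMap.mul' ℤ BQSym (TensorProduct.map S T (comulHom f)) =
      algebraMap ℤ BQSym (counitHom f) := by
  induction f using mono_induction with
  | basis n l =>
    rcases n with _ | n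
    · rw [pow_zero, one_mul]
      rcases l with _ | ⟨a, l⟩
      · rw [mono_nil, map_one, Algebra.TensorProduct.one_def, TensorProduct.map_tmul,
          LinearMap.mul'_apply, h1, map_one, map_one]
      · rw [comulHom_mono, deconcat_eq_sum, map_sum, map_sum, counitHom_mono_cons, map_zero]
        simpa only [TensorProduct.map_tmul, LinearMap.mul'_apply] using h a l
    · rw [comulHom_x₀_pow_mul_mono, pow_succ', mul_assoc, mul_map_x₀₀_mul hS hT, pow_succ',
        mul_assoc, map_mul, counitHom_x₀, zero_mul, map_zero]
  | zero => simp only [map_zero]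
  | add f g hf hg => simp only [map_add, hf, hg]
  | smul c f hf => rw [map_smul, map_smul, map_smul, hf, map_smul, Algebra.algebraMap_eq_smul_one,
      Algebra.algebraMap_eq_smul_one, smul_assoc]

/-- The antipode of `BQSym`. -/
noncomputable def antipodeMap : BQSym →ₗ[ℤ] BQSym := (addLift (-x₀) leftInverse).toIntLinearMap

/-- The antipode of `BQSym`, as a right inverse of the identity for convolution. -/
noncomputable def antipodeMap' : BQSym →ₗ[ℤ] BQSym := (addLift (-x₀) rightInverse).toIntLinearMap

theorem toIntLinearMap_addLift_x₀_mul (u : List ℕ+ → BQSym) (f : BQSym) :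
    (addLift (-x₀) u).toIntLinearMap (x₀ * f) = -(x₀ * (addLift (-x₀) u).toIntLinearMap f) := by
  have := addLift_x₀_pow_mul (-x₀) u 1 f
  rw [pow_one, pow_one, neg_mul] at this
  exact this

theorem toIntLinearMap_addLift_mono (u : List ℕ+ → BQSym) (l : List ℕ+) :
    (addLift (-x₀) u).toIntLinearMap (mono l) = u l := by
  rw [AddMonoidHom.coe_toIntLinearMap, addLift_mono]

theorem mul_map_antipodeMap_comul (f : BQSym) :
    LinearMap.mul' ℤ BQSym (TensorProduct.map antipodeMap LinearMap.id (comulHom f)) =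
      algebraMap ℤ BQSym (counitHom f) := by
  refine mul_map_comul (c := -x₀) (fun f => ?_) (fun f => ?_) ?_ (fun a l => ?_) f
  · rw [antipodeMap, toIntLinearMap_addLift_x₀_mul, neg_mul]
  · rw [LinearMap.id_apply, LinearMap.id_apply, neg_mul, neg_neg]
  · rw [LinearMap.id_apply, mul_one, antipodeMap, ← mono_nil, toIntLinearMap_addLift_mono,
      leftInverse_nil, mono_nil]
  · simp only [antipodeMap, toIntLinearMap_addLift_mono, LinearMap.id_apply]
    exact sum_leftInverse_mul a l

theorem mul_map_comul_antipodeMap' (f : BQSym) :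
    LinearMap.mul' ℤ BQSym (TensorProduct.map LinearMap.id antipodeMap' (comulHom f)) =
      algebraMap ℤ BQSym (counitHom f) := by
  refine mul_map_comul (c := x₀) (fun f => ?_) (fun f => ?_) ?_ (fun a l => ?_) f
  · rw [LinearMap.id_apply, LinearMap.id_apply]
  · rw [antipodeMap', toIntLinearMap_addLift_x₀_mul]
  · rw [LinearMap.id_apply, one_mul, antipodeMap', ← mono_nil, toIntLinearMap_addLift_mono,
      rightInverse_nil, mono_nil]
  · simp only [antipodeMap', toIntLinearMap_addLift_mono, LinearMap.id_apply]
    exact sum_mul_rightInverse a l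

theorem toConv_antipodeMap_mul :
    WithConv.toConv antipodeMap * WithConv.toConv (LinearMap.id : BQSym →ₗ[ℤ] BQSym) = 1 :=
  congrArg WithConv.toConv (LinearMap.ext mul_map_antipodeMap_comul)

/-- Both recursions give one-sided convolution inverses of the identity, and in a monoid a left and
a right inverse coincide. -/
theorem mul_toConv_antipodeMap :
    WithConv.toConv (LinearMap.id : BQSym →ₗ[ℤ] BQSym) * WithConv.toConv antipodeMap = 1 := by
  have h : WithConv.toConv (LinearMap.id : BQSym →ₗ[ℤ] BQSym) * WithConv.toConv antipodeMap' = 1 :=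
    congrArg WithConv.toConv (LinearMap.ext mul_map_comul_antipodeMap')
  rwa [← left_inv_eq_right_inv toConv_antipodeMap_mul h] at h

theorem isHopfAlgebra : IsHopfAlgebra antipodeMap where
  counit_one := map_one counitHom
  counit_mul := map_mul counitHom
  comul_one := map_one comulHom
  comul_mul := map_mul comulHom
  mul_antipode_rTensor_comul := congrArg WithConv.ofConv toConv_antipodeMap_mul
  mul_antipode_lTensor_comul := congrArg WithConv.ofConv mul_toConv_antipodeMap

/-- Θ ∘ S is a left and S ∘ Θ a right convolution inverse of Θ: the first because Θ is an algebra
map, the second because it is a coalgebra map. -/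
theorem bialgHom_antipodeMap (Θ : BQSym →ₐc[ℤ] BQSym) (f : BQSym) :
    Θ (antipodeMap f) = antipodeMap (Θ f) := by
  let θ : BQSym →ₗ[ℤ] BQSym := (Θ : BQSym →ₐ[ℤ] BQSym).toLinearMap
  have hone : ∀ f, θ (algebraMap ℤ BQSym (counitHom f)) = algebraMap ℤ BQSym (counitHom f) :=
    fun f => AlgHomClass.commutes Θ _
  have hcounit : ∀ f, counitHom (θ f) = counitHom f :=
    fun f => CoalgHomClass.counit_comp_apply Θ f
  have h1 : WithConv.toConv (θ ∘ₗ antipodeMap) * WithConv.toConv θ = 1 := by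
    have := LinearMap.algHom_comp_convMul_distrib (Θ : BQSym →ₐ[ℤ] BQSym)
      (WithConv.toConv antipodeMap) (WithConv.toConv (LinearMap.id : BQSym →ₗ[ℤ] BQSym))
    rw [toConv_antipodeMap_mul] at this
    refine WithConv.ofConv_injective (this.symm.trans ?_)
    exact LinearMap.ext hone
  have h2 : WithConv.toConv θ * WithConv.toConv (antipodeMap ∘ₗ θ) = 1 := by
    have := LinearMap.convMul_comp_coalgHom_distrib
      (WithConv.toConv (LinearMap.id : BQSym →ₗ[ℤ] BQSym)) (WithConv.toConv antipodeMap)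
      (Θ : BQSym →ₗc[ℤ] BQSym)
    rw [mul_toConv_antipodeMap] at this
    refine WithConv.ofConv_injective (this.symm.trans ?_)
    exact LinearMap.ext fun f => congrArg (algebraMap ℤ BQSym) (hcounit f)
  exact DFunLike.congr_fun (WithConv.toConv_injective (left_inv_eq_right_inv h1 h2)) f

end Antipode

/-! ### The peak map as a bialgebra endomorphism. -/

section PeakMap

attribute [local instance 2000] TensorProduct.instModule Algebra.TensorProduct.leftAlgebra

theorem addLift_peak_ofWords (f : Words) :
    addLift x₀ (fun l => ofWords (peak l)) (ofWords f) = ofWords (peakWords f) := by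
  induction f using Finsupp.induction_linear with
  | zero => simp only [map_zero]
  | add f g hf hg => simp only [map_add, hf, hg]
  | single l c =>
    have : Finsupp.single l c = c • of l := by simp
    rw [this]
    simp only [map_zsmul, ofWords_of, addLift_mono, peakWords, Finsupp.linearCombination_single,
      one_smul]

/-- The type B peak map as an algebra homomorphism. -/
noncomputable def peakHom : BQSym →ₐ[ℤ] BQSym :=
  algLift x₀ (fun l => ofWords (peak l)) (by rw [peak_nil, ofWords_of, mono_nil]) fun l k => by
    rw [mono_mul_mono, addLift_peak_ofWords, ofWords_peak_mul]

theorem peakHom_x₀_pow_mul_mono (n : ℕ) (l : List ℕ+) :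
    peakHom (x₀ ^ n * mono l) = x₀ ^ n * ofWords (peak l) := by
  rw [peakHom, algLift_apply, addLift_apply]

theorem peakHom_mono (l : List ℕ+) : peakHom (mono l) = ofWords (peak l) := by
  rw [peakHom, algLift_apply, addLift_mono]

theorem peakHom_x₀ : peakHom x₀ = x₀ := by
  have := peakHom_x₀_pow_mul_mono 1 []
  rwa [mono_nil, mul_one, pow_one, peak_nil, ofWords_of, mono_nil, mul_one] at this

theorem counitHom_ofWords_cons (a : ℕ+) (f : Words) : counitHom (ofWords (cons a f)) = 0 := by
  induction f using Finsupp.induction_linear with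
  | zero => simp only [map_zero]
  | add f g hf hg => simp only [map_add, hf, hg, add_zero]
  | single l c =>
    have : Finsupp.single l c = c • of l := by simp
    rw [this]
    simp only [map_zsmul, cons_of, ofWords_of, counitHom_mono_cons, smul_zero]

theorem counitHom_openPeak (s : ℕ+) (l : List ℕ+) : counitHom (ofWords (openPeak s l)) = 0 := by
  induction l generalizing s with
  | nil => rw [openPeak_nil, ofWords_of, counitHom_mono_cons]
  | cons a l ih =>
    rw [openPeak_cons]
    simp only [map_add, map_zsmul, counitHom_ofWords_cons, ih, smul_zero, add_zero]

theorem counitHom_peakHom : counitHom.comp peakHom = counitHom := by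
  refine algHom_ext ?_ fun l => ?_
  · rw [AlgHom.comp_apply, peakHom_x₀]
  · rw [AlgHom.comp_apply, peakHom_mono]
    rcases l with _ | ⟨a, l⟩
    · rw [peak_nil, ofWords_of]
    · rw [peak_cons]
      simp only [map_add, map_zsmul, counitHom_ofWords_cons, counitHom_openPeak, smul_zero,
        add_zero, counitHom_mono_cons]

theorem comulHom_ofWords_cons (a : ℕ+) (f : Words) : comulHom (ofWords (cons a f)) =
    1 ⊗ₜ ofWords (cons a f) + consLeft a BQSym (comulHom (ofWords f)) :=
  by rw [comulHom_apply, comulHom_apply, addLift_deconcat_ofWords_cons]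

/-- A merged word can only be cut between blocks. The two formulas are proved together because
`peak` recurses through `openPeak`. The extra term 1 ⊗ … is the cut before the open block, which the
sum misses because the open block always stays in its left factor. -/
theorem comulHom_peak_and_openPeak (l : List ℕ+) :
    comulHom (ofWords (peak l)) = ∑ j ∈ Finset.range (l.length + 1),
      ofWords (peak (l.take j)) ⊗ₜ[ℤ] ofWords (peak (l.drop j)) ∧
    ∀ s, comulHom (ofWords (openPeak s l)) = 1 ⊗ₜ ofWords (openPeak s l) +
      ∑ j ∈ Finset.range (l.length + 1),
        ofWords (openPeak s (l.take j)) ⊗ₜ[ℤ] ofWords (peak (l.drop j)) := by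
  induction l with
  | nil =>
    have h1 : ofWords (peak []) = 1 := by rw [peak_nil, ofWords_of, mono_nil]
    refine ⟨?_, fun s => ?_⟩
    · simp only [List.length_nil, zero_add, Finset.sum_range_one, List.take_nil, List.drop_nil, h1,
        map_one, Algebra.TensorProduct.one_def]
    · simp only [List.length_nil, zero_add, Finset.sum_range_one, List.take_nil, List.drop_nil, h1]
      rw [openPeak_nil, ← cons_of, comulHom_ofWords_cons, ofWords_of, mono_nil, map_one,
        Algebra.TensorProduct.one_def, consLeft_tmul, ← mono_nil, ← ofWords_of, consPart_ofWords]
  | cons a l ih =>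
    obtain ⟨ih1, ih2⟩ := ih
    have h1 : ofWords (peak []) = 1 := by rw [peak_nil, ofWords_of, mono_nil]
    have hp : comulHom (ofWords (peak (a :: l))) = 1 ⊗ₜ ofWords (peak (a :: l)) +
        ∑ j ∈ Finset.range (l.length + 1),
          ofWords (peak (a :: l.take j)) ⊗ₜ[ℤ] ofWords (peak (l.drop j)) := by
      simp only [peak_cons, map_add, map_zsmul, comulHom_ofWords_cons, ih1, ih2, map_sum,
        consLeft_tmul, consPart_ofWords, TensorProduct.tmul_add, TensorProduct.add_tmul,
        Finset.sum_add_distrib, smul_add, Finset.smul_sum, TensorProduct.tmul_smul,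
        TensorProduct.smul_tmul']
      abel
    refine ⟨?_, fun s => ?_⟩
    · rw [List.length_cons, Finset.sum_range_succ', hp, List.take_zero, List.drop_zero, h1,
        add_comm]
      simp only [List.take_succ_cons, List.drop_succ_cons]
    · rw [List.length_cons, Finset.sum_range_succ', List.take_zero, List.drop_zero]
      simp only [List.take_succ_cons, List.drop_succ_cons]
      have h2 : ofWords (openPeak s []) = consPart s 1 := by
        rw [openPeak_nil, ← cons_of, ← consPart_ofWords, ofWords_of, mono_nil]
      simp only [openPeak_cons, map_add, map_zsmul, comulHom_ofWords_cons, hp, ih1, ih2, map_sum,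
        consLeft_tmul, consPart_ofWords, TensorProduct.tmul_add, TensorProduct.add_tmul, h2,
        Finset.sum_add_distrib, smul_add, Finset.smul_sum, TensorProduct.tmul_smul,
        TensorProduct.smul_tmul']
      abel

theorem map_peakHom_comulHom :
    (Algebra.TensorProduct.map peakHom peakHom).comp comulHom = comulHom.comp peakHom := by
  refine algHom_ext ?_ fun l => ?_
  · simp only [AlgHom.comp_apply, comulHom_x₀, map_add, Algebra.TensorProduct.map_tmul, map_one,
      peakHom_x₀]
  · simp only [AlgHom.comp_apply, comulHom_mono, deconcat_eq_sum, map_sum,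
      Algebra.TensorProduct.map_tmul, peakHom_mono, (comulHom_peak_and_openPeak l).1]

attribute [local instance] bialgebra

/-- The type B peak map as a bialgebra homomorphism. -/
noncomputable def peakBialgHom : BQSym →ₐc[ℤ] BQSym :=
  BialgHom.ofAlgHom peakHom counitHom_peakHom map_peakHom_comulHom

end PeakMap

end BQSym

/-! ### The splitting BQSym ≅ ℤ[X] ⊗ QSym. -/

namespace BQSym

theorem mono_mem_QSym (l : List ℕ+) : mono l ∈ QSym := by
  classical
  intro d hd
  obtain ⟨xs, hs, h0, hm⟩ := exists_sorted_variables d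
  change MvPowerSeries.coeff d (monomialSeries _) = 0
  rw [coeff_monomialSeries_eq_values hs h0 hm]
  exact if_neg fun h => hd h.1

theorem ofWords_mem_QSym (f : Words) : ofWords f ∈ QSym := by
  induction f using Finsupp.induction_linear with
  | zero => rw [map_zero]; exact QSym.zero_mem
  | add f g hf hg => rw [map_add]; exact QSym.add_mem hf hg
  | single l c =>
    have : Finsupp.single l c = c • of l := by simp
    rw [this, map_zsmul, ofWords_of]
    exact QSym.zsmul_mem (mono_mem_QSym l) c

/-- In the monomial expansion, every term with positive first part has as coefficient that of a
monomial divisible by x₀, which is zero. -/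
theorem exists_ofWords_eq {f : BQSym} (hf : f ∈ QSym) : ∃ w, ofWords w = f := by
  change f ∈ LinearMap.range ofWords
  obtain ⟨s, hs⟩ := exists_eq_sum_M f
  rw [hs]
  refine Submodule.sum_mem _ fun α _ => ?_
  obtain ⟨n, l, rfl⟩ := α.exists_ofParts
  rcases n with _ | n
  · exact Submodule.smul_mem _ _ ⟨of l, ofWords_of l⟩
  · have h : dual (ofParts (n + 1) l) f = 0 := hf _ (by
      rw [exponent_zero fun j => Nat.succ_pos _]
      exact Nat.succ_ne_zero n)
    rw [h, zero_smul]
    exact Submodule.zero_mem _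

/-- The function `mono l` as an element of `QSym`. -/
noncomputable def qmono (l : List ℕ+) : QSym := ⟨mono l, mono_mem_QSym l⟩

theorem qsym_induction {p : QSym → Prop} (f : QSym) (mono : ∀ l, p (qmono l)) (zero : p 0)
    (add : ∀ f g, p f → p g → p (f + g)) (smul : ∀ (c : ℤ) f, p f → p (c • f)) : p f := by
  have key : ∀ w, p ⟨ofWords w, ofWords_mem_QSym w⟩ := fun w => by
    induction w using Finsupp.induction_linear with
    | zero =>
      convert zero
      exact map_zero ofWords
    | add f g hf hg =>
      convert add _ _ hf hg
      exact map_add ofWords f g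
    | single l c =>
      convert smul c _ (mono l)
      have : Finsupp.single l c = c • of l := by simp
      rw [this, map_zsmul, ofWords_of]
      rfl
  obtain ⟨f, hf⟩ := f
  obtain ⟨w, rfl⟩ := exists_ofWords_eq hf
  exact key w

/-- The ring homomorphism `p ⊗ q ↦ p(x_0) q`. -/
noncomputable def polynomialTensorHom : TensorProduct ℤ (Polynomial ℤ) QSym →ₐ[ℤ] BQSym :=
  Algebra.TensorProduct.productMap (Polynomial.aeval (R := ℤ) x₀) QSym.subtype.toIntAlgHom

theorem polynomialTensorHom_tmul (p : Polynomial ℤ) (q : QSym) :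
    polynomialTensorHom (p ⊗ₜ[ℤ] q) = Polynomial.aeval x₀ p * (q : BQSym) :=
  Algebra.TensorProduct.productMap_apply_tmul _ _ _ _

/-- The additive inverse of `polynomialTensorHom`. -/
noncomputable def polynomialTensorInv : BQSym →+ TensorProduct ℤ (Polynomial ℤ) QSym :=
  (basis.constr ℤ fun p => (Polynomial.X ^ p.1 : Polynomial ℤ) ⊗ₜ[ℤ] qmono p.2).toAddMonoidHom

theorem polynomialTensorInv_apply (n : ℕ) (l : List ℕ+) : polynomialTensorInv (x₀ ^ n * mono l) =
    (Polynomial.X ^ n : Polynomial ℤ) ⊗ₜ[ℤ] qmono l := by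
  rw [← basis_apply]
  exact basis.constr_basis ℤ _ _

theorem polynomialTensorInv_polynomialTensorHom (t : TensorProduct ℤ (Polynomial ℤ) QSym) :
    polynomialTensorInv (polynomialTensorHom t) = t := by
  induction t with
  | zero => rw [map_zero, map_zero]
  | add x y hx hy => rw [map_add, map_add, hx, hy]
  | tmul p q =>
    rw [polynomialTensorHom_tmul]
    induction q using qsym_induction with
    | mono l =>
      induction p using Polynomial.induction_on' with
      | add p q hp hq => rw [map_add, add_mul, map_add, hp, hq, TensorProduct.add_tmul]
      | monomial n c =>
        have : Polynomial.monomial n c = c • (Polynomial.X ^ n : Polynomial ℤ) := by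
          rw [← Polynomial.C_mul_X_pow_eq_monomial, eq_intCast, zsmul_eq_mul]
        rw [this, map_zsmul, map_pow, Polynomial.aeval_X, smul_mul_assoc, map_zsmul]
        change c • polynomialTensorInv (x₀ ^ n * mono l) = _
        rw [polynomialTensorInv_apply, TensorProduct.smul_tmul']
    | zero => rw [ZeroMemClass.coe_zero, mul_zero, map_zero, TensorProduct.tmul_zero]
    | add f g hf hg => rw [Subring.coe_add, mul_add, map_add, hf, hg, TensorProduct.tmul_add]
    | smul c f hf =>
      have : ((c • f : QSym) : BQSym) = c • (f : BQSym) := rfl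
      rw [this, mul_smul_comm, map_zsmul, hf, TensorProduct.tmul_smul]

theorem polynomialTensorHom_bijective : Function.Bijective polynomialTensorHom := by
  refine ⟨Function.LeftInverse.injective polynomialTensorInv_polynomialTensorHom, fun f => ?_⟩
  change f ∈ Set.range polynomialTensorHom
  induction f using mono_induction with
  | basis n l =>
    refine ⟨(Polynomial.X ^ n : Polynomial ℤ) ⊗ₜ[ℤ] qmono l, ?_⟩
    rw [polynomialTensorHom_tmul, map_pow, Polynomial.aeval_X]
    rfl
  | zero => exact ⟨0, map_zero _⟩
  | add f g hf hg =>
    obtain ⟨x, rfl⟩ := hf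
    obtain ⟨y, rfl⟩ := hg
    exact ⟨x + y, map_add _ _ _⟩
  | smul c f hf =>
    obtain ⟨x, rfl⟩ := hf
    exact ⟨c • x, map_zsmul _ _ _⟩

/-- The isomorphism `ℤ[X] ⊗ QSym ≃ BQSym`. -/
noncomputable def polynomialTensorEquiv : TensorProduct ℤ (Polynomial ℤ) QSym ≃ₐ[ℤ] BQSym :=
  AlgEquiv.ofBijective polynomialTensorHom polynomialTensorHom_bijective

theorem polynomialTensorEquiv_tmul (p : Polynomial ℤ) (q : QSym) :
    polynomialTensorEquiv (p ⊗ₜ[ℤ] q) = Polynomial.aeval x₀ p * (q : BQSym) :=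
  polynomialTensorHom_tmul p q

theorem peakHom_ofWords (f : Words) : peakHom (ofWords f) = ofWords (peakWords f) := by
  rw [peakHom, algLift_apply, addLift_peak_ofWords]

theorem peakHom_mem_QSym (q : QSym) : peakHom (q : BQSym) ∈ QSym := by
  obtain ⟨w, hw⟩ := exists_ofWords_eq q.2
  rw [← hw, peakHom_ofWords]
  exact ofWords_mem_QSym _

/-- The peak map restricted to `QSym`. -/
noncomputable def qsymPeakHom : QSym →ₐ[ℤ] QSym :=
  (((peakHom : BQSym →+* BQSym).comp QSym.subtype).codRestrict QSym peakHom_mem_QSym).toIntAlgHom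

theorem coe_qsymPeakHom (q : QSym) : (qsymPeakHom q : BQSym) = peakHom (q : BQSym) := rfl

theorem peakHom_polynomialTensorEquiv (t : TensorProduct ℤ (Polynomial ℤ) QSym) :
    peakHom (polynomialTensorEquiv t) = polynomialTensorEquiv
      (Algebra.TensorProduct.map (AlgHom.id ℤ (Polynomial ℤ)) qsymPeakHom t) := by
  induction t with
  | zero => simp only [map_zero]
  | add x y hx hy => simp only [map_add, hx, hy]
  | tmul p q =>
    rw [Algebra.TensorProduct.map_tmul, polynomialTensorEquiv_tmul, polynomialTensorEquiv_tmul,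
      map_mul, coe_qsymPeakHom, AlgHom.id_apply]
    congr 1
    have : peakHom.comp (Polynomial.aeval x₀) = Polynomial.aeval x₀ := by
      refine Polynomial.algHom_ext ?_
      rw [AlgHom.comp_apply, Polynomial.aeval_X, peakHom_x₀]
    exact DFunLike.congr_fun this p

end BQSym

/-! ### Binary words and the coefficients of the peak map. -/

namespace BinaryWord

/-- The pointwise order on binary words of equal length. -/
def le : List Bool → List Bool → Bool
  | [], [] => true
  | b :: v, c :: w => (!b || c) && le v w
  | _, _ => false

/-- All binary words of length `n`. -/
def words : ℕ → Finset (List Bool)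
  | 0 => {[]}
  | n + 1 => (words n).image (List.cons true) ∪ (words n).image (List.cons false)

theorem mem_words {n : ℕ} {w : List Bool} : w ∈ words n ↔ w.length = n := by
  induction n generalizing w with
  | zero => simp [words]
  | succ n ih =>
    rcases w with _ | ⟨b, w⟩
    · simp [words]
    · cases b <;> simp [words, ih]

theorem sum_words_succ {E : Type*} [AddCommMonoid E] (n : ℕ) (f : List Bool → E) :
    ∑ v ∈ words (n + 1), f v = ∑ v ∈ words n, f (true :: v) + ∑ v ∈ words n, f (false :: v) := by
  rw [words, Finset.sum_union, Finset.sum_image, Finset.sum_image]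
  · intro a _ b _ h; exact (List.cons.inj h).2
  · intro a _ b _ h; exact (List.cons.inj h).2
  · rw [Finset.disjoint_left]
    intro a ha hb
    obtain ⟨x, _, rfl⟩ := Finset.mem_image.1 ha
    obtain ⟨y, _, h⟩ := Finset.mem_image.1 hb
    exact absurd (List.cons.inj h).1 (by simp)

/-- All binary words above `w`. -/
def ups (w : List Bool) : Finset (List Bool) := (words w.length).filter fun v => le w v

theorem sum_ups_nil {E : Type*} [AddCommMonoid E] (f : List Bool → E) :
    ∑ v ∈ ups [], f v = f [] := by
  simp [ups, words, Finset.sum_filter, le]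

theorem sum_ups_true {E : Type*} [AddCommMonoid E] (w : List Bool) (f : List Bool → E) :
    ∑ v ∈ ups (true :: w), f v = ∑ v ∈ ups w, f (true :: v) := by
  simp [ups, Finset.sum_filter, sum_words_succ, le]

theorem sum_ups_false {E : Type*} [AddCommMonoid E] (w : List Bool) (f : List Bool → E) :
    ∑ v ∈ ups (false :: w), f v = ∑ v ∈ ups w, f (true :: v) + ∑ v ∈ ups w, f (false :: v) := by
  simp [ups, Finset.sum_filter, sum_words_succ, le]

/-- Möbius inversion on the Boolean lattice, one coordinate at a time: the sum above false :: v
minus the sum above true :: v runs only over words starting with false. -/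
theorem mem_of_sum_ups_mem {E : Type*} [AddCommGroup E] (P : Submodule ℤ E) (w : List Bool)
    (X : List Bool → E) (h : ∀ v, v.length = w.length → ∑ u ∈ ups v, X u ∈ P) : X w ∈ P := by
  induction w generalizing X with
  | nil => simpa only [sum_ups_nil] using h [] rfl
  | cons b w ih =>
    have ht : ∀ v, v.length = w.length → ∑ u ∈ ups v, X (true :: u) ∈ P := fun v hv => by
      rw [← sum_ups_true]
      exact h _ (by rw [List.length_cons, List.length_cons, hv])
    cases b with
    | true => exact ih (fun v => X (true :: v)) ht
    | false =>
      refine ih (fun v => X (false :: v)) fun v hv => ?_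
      have h1 := P.sub_mem (h (false :: v) (by rw [List.length_cons, List.length_cons, hv]))
        (ht v hv)
      rwa [sum_ups_false, add_sub_cancel_left] at h1

theorem le_iff {v w : List Bool} : le v w = true ↔
    v.length = w.length ∧ ∀ j : ℕ, v[j]? = some true → w[j]? = some true := by
  induction v generalizing w with
  | nil => cases w <;> simp [le]
  | cons b v ih =>
    rcases w with _ | ⟨c, w⟩
    · simp [le]
    · simp only [le, Bool.and_eq_true, ih, List.length_cons, Nat.add_right_cancel_iff]
      constructor
      · rintro ⟨h1, h2, h3⟩
        refine ⟨h2, fun j => ?_⟩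
        rcases j with _ | j
        · revert h1
          cases b <;> cases c <;> simp
        · simpa using h3 j
      · rintro ⟨h1, h2⟩
        refine ⟨?_, h1, fun j => by simpa using h2 (j + 1)⟩
        have := h2 0
        revert this
        cases b <;> cases c <;> simp

/-- The indicator word of `B ∪ (B + 1)`, where `p` tells whether the position before the word
is in `B`. -/
def star : Bool → List Bool → List Bool
  | _, [] => []
  | p, b :: w => (p || b) :: star b w

/-- The indicator word of `B \ (B + 1)`, where `p` tells whether the position before the word
is in `B`. -/
def hat : Bool → List Bool → List Bool
  | _, [] => []
  | p, b :: w => (b && !p) :: hat b w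

theorem star_replicate (n : ℕ) (w : List Bool) :
    star false (List.replicate n false ++ w) = List.replicate n false ++ star false w := by
  induction n with
  | zero => rfl
  | succ n ih => simp [List.replicate_succ, star, ih]

theorem hat_replicate (n : ℕ) (w : List Bool) :
    hat false (List.replicate n false ++ w) = List.replicate n false ++ hat false w := by
  induction n with
  | zero => rfl
  | succ n ih => simp [List.replicate_succ, hat, ih]

/-- The coefficients of the peak map from fundamental to monomial functions; `p` tells whether
the position before the words is in one of them. -/
def weight : Bool → List Bool → List Bool → ℤ
  | _, [], [] => 1
  | _, true :: u, _ :: w => 2 * weight true u w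
  | _, false :: u, false :: w => weight false u w
  | true, false :: u, true :: w => weight true u w
  | false, false :: _, true :: _ => 0
  | _, _, _ => 0

/-- The inequality fails at a position only if w has it, u does not, and the previous position lies
in neither. So of the two preceding bits p and q only their disjunction matters, and `weight` can
carry a single state. -/
theorem weight_eq {u w : List Bool} (h : u.length = w.length) (p q : Bool) :
    weight (p || q) u w = if le (hat p w) (star q u) then 2 ^ u.count true else 0 := by
  induction u generalizing w p q with
  | nil =>
    rcases w with _ | ⟨b, w⟩
    · simp [weight, hat, star, le]
    · simp at h
  | cons a u ih =>
    rcases w with _ | ⟨b, w⟩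
    · simp at h
    have ih' := fun p q => ih (w := w) (by simpa using h) p q
    have h1 := ih' true true
    have h2 := ih' false true
    have h3 := ih' true false
    have h4 := ih' false false
    simp only [Bool.or_true, Bool.or_false] at h1 h2 h3 h4
    cases a <;> cases b
    · cases p <;> cases q <;> simp [weight, hat, star, le, h4]
    · cases p <;> cases q <;> simp [weight, hat, star, le, h3]
    · cases p <;> cases q <;> simp [weight, hat, star, le, h2, pow_succ']
    · cases p <;> cases q <;> simp [weight, hat, star, le, h1, pow_succ']

/-- The size of the first part, `s` of which precedes the word. -/
def first : ℕ+ → List Bool → ℕ+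
  | s, [] => s
  | s, false :: v => first (s + 1) v
  | s, true :: _ => s

/-- All parts after the first. -/
def rest : List Bool → List ℕ+
  | [] => []
  | false :: v => rest v
  | true :: v => first 1 v :: rest v

theorem first_add (s t : ℕ+) (v : List Bool) : first (t + s) v = t + first s v := by
  induction v generalizing s with
  | nil => rfl
  | cons b v ih =>
    cases b
    · rw [first, first, add_assoc, ih]
    · rfl

/-- The sum over the ways to close an open block of size `t` at the end of its current part. -/
noncomputable def closing (t : ℕ+) (v : List Bool) : Words := cons (first t v) (peak (rest v))

/-- The sum over the ways to continue an open block of size `t` after its current part. -/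
noncomputable def continuing (t : ℕ+) (v : List Bool) : Words :=
  sgn (first 1 v) • openPeak (first t v) (rest v)

theorem closing_false (t : ℕ+) (v : List Bool) : closing t (false :: v) = closing (t + 1) v := rfl

theorem closing_true (t : ℕ+) (v : List Bool) :
    closing t (true :: v) = cons t (peak (first 1 v :: rest v)) := rfl

theorem sgn_one_add (a : ℕ+) : sgn (1 + a) = -sgn a := by
  rw [sgn, sgn, PNat.add_coe, pow_add, PNat.one_coe, pow_one, neg_one_mul]

/-- Lengthening the current part by one flips its parity, hence its sign. -/
theorem continuing_false (t : ℕ+) (v : List Bool) :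
    continuing t (false :: v) = -continuing (t + 1) v := by
  rw [continuing, continuing, first, first, rest, first_add, sgn_one_add, neg_smul]

theorem peak_first_rest (v : List Bool) :
    peak (first 1 v :: rest v) = closing 1 v + continuing 1 v := peak_cons _ _

theorem continuing_true (t : ℕ+) (v : List Bool) : continuing t (true :: v) =
    cons t (peak (first 1 v :: rest v)) + closing (t + 1) v + continuing (t + 1) v := by
  have h : sgn 1 = 1 := by simp [sgn]
  rw [continuing, first, first, rest, h, one_smul, openPeak_cons, closing, continuing, first_add]

/-- The heart of F ↦ K. Both sums satisfy the recursion of `weight` on the first bit of w; a new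
part starting there is itself a closing plus a continuing sum, so `weight false` cancels and 2
`weight true` remains. The size t is general because reading a bit enlarges the open block. -/
theorem sum_closing_continuing (w : List Bool) (t : ℕ+) :
    ∑ v ∈ ups w, closing t v =
      ∑ u ∈ words w.length, weight false u w • of (first t u :: rest u) ∧
    ∑ v ∈ ups w, continuing t v =
      ∑ u ∈ words w.length,
        (2 * weight true u w - weight false u w) • of (first t u :: rest u) := by
  induction w generalizing t with
  | nil =>
    simp only [sum_ups_nil, List.length_nil, words, Finset.sum_singleton, weight]
    simp [closing, continuing, first, rest, peak_nil, openPeak_nil, sgn]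
  | cons b w ih =>
    have hp : ∑ v ∈ ups w, cons t (peak (first 1 v :: rest v)) =
        ∑ u ∈ words w.length, (2 * weight true u w) • of (t :: first 1 u :: rest u) := by
      simp only [peak_first_rest]
      rw [← map_sum, Finset.sum_add_distrib, (ih 1).1, (ih 1).2, ← Finset.sum_add_distrib, map_sum]
      refine Finset.sum_congr rfl fun u _ => ?_
      rw [← add_smul, map_zsmul, cons_of, add_sub_cancel]
    obtain ⟨ih1, ih2⟩ := ih (t + 1)
    cases b with
    | true =>
      simp only [sum_ups_true, closing_true, continuing_true, Finset.sum_add_distrib, hp, ih1, ih2,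
        List.length_cons, sum_words_succ, weight, first, rest, zero_smul, Finset.sum_const_zero,
        add_zero, true_and, sub_zero]
      rw [add_assoc, ← Finset.sum_add_distrib]
      congr 1
      · refine Finset.sum_congr rfl fun u _ => ?_
        congr 1
        ring
      · refine Finset.sum_congr rfl fun u _ => ?_
        rw [← add_smul, add_sub_cancel]
    | false =>
      simp only [sum_ups_false, closing_true, closing_false, continuing_true, continuing_false,
        Finset.sum_add_distrib, Finset.sum_neg_distrib, hp, ih1, ih2,
        List.length_cons, sum_words_succ, weight, first, rest, true_and]
      -- At an unconstrained bit, keeping the block open across a new part cancels against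
      -- lengthening the current part, which has the opposite sign.
      rw [add_assoc, add_assoc, add_neg_cancel, add_zero]
      congr 1 <;>
      · refine Finset.sum_congr rfl fun u _ => ?_
        congr 1
        ring

end BinaryWord

/-! ### Pseudo-compositions as binary words. -/

namespace PseudoComposition

/-- The indicator word of the partial sums of a list of positive integers, the total sum
excluded. -/
def tailBits : List ℕ → List Bool
  | [] => []
  | b :: t => true :: (List.replicate (b - 1) false ++ tailBits t)

/-- The indicator word of the partial sums of a pseudo-composition. -/
def bits (α : PseudoComposition) : List Bool :=
  List.replicate α.head false ++ tailBits α.tail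

/-- The number of leading zeros of a binary word. -/
def leading : List Bool → ℕ
  | false :: v => leading v + 1
  | _ => 0

/-- The pseudo-composition with a given indicator word of partial sums. -/
def ofBits (w : List Bool) : PseudoComposition := ofParts (leading w) (BinaryWord.rest w)

open BinaryWord

theorem coe_first (s : ℕ+) (v : List Bool) : (first s v : ℕ) = s + leading v := by
  induction v generalizing s with
  | nil => rfl
  | cons b v ih =>
    cases b
    · rw [first, ih, leading, PNat.add_coe, PNat.one_coe, add_assoc, add_comm 1]
    · rfl

theorem bits_ofBits (w : List Bool) : bits (ofBits w) = w := by
  induction w with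
  | nil => rfl
  | cons b v ih =>
    simp only [bits, ofBits, ofParts] at ih ⊢
    cases b
    · rw [leading, rest, List.replicate_succ, List.cons_append, ih]
    · simp only [leading, rest, List.map_cons, tailBits, coe_first, PNat.one_coe,
        Nat.add_sub_cancel_left, ih, List.replicate_zero, List.nil_append]

theorem leading_replicate_append_tailBits (n : ℕ) (t : List ℕ) :
    leading (List.replicate n false ++ tailBits t) = n := by
  induction n with
  | zero => cases t <;> rfl
  | succ n ih => rw [List.replicate_succ, List.cons_append, leading, ih]

theorem rest_replicate_append (n : ℕ) (w : List Bool) :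
    rest (List.replicate n false ++ w) = rest w := by
  induction n with
  | zero => rfl
  | succ n ih => rw [List.replicate_succ, List.cons_append, rest, ih]

theorem rest_tailBits (l : List ℕ+) : rest (tailBits (l.map (↑))) = l := by
  induction l with
  | nil => rfl
  | cons a l ih =>
    rw [List.map_cons, tailBits, rest, rest_replicate_append, ih]
    congr 1
    apply PNat.eq
    rw [coe_first, leading_replicate_append_tailBits, PNat.one_coe]
    have := a.pos
    omega

theorem ofBits_bits (α : PseudoComposition) : ofBits (bits α) = α := by
  obtain ⟨n, l, rfl⟩ := exists_ofParts α
  rw [ofBits, bits, leading_replicate_append_tailBits, rest_replicate_append]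
  congr 1
  exact rest_tailBits l

theorem length_tailBits {t : List ℕ} (ht : ∀ x ∈ t, 0 < x) : (tailBits t).length = t.sum := by
  induction t with
  | nil => rfl
  | cons b t ih =>
    have hb := ht b (by simp)
    rw [tailBits, List.length_cons, List.length_append, List.length_replicate,
      ih fun x hx => ht x (by simp [hx]), List.sum_cons]
    omega

theorem length_bits (α : PseudoComposition) : (bits α).length = α.size := by
  rw [bits, List.length_append, List.length_replicate, length_tailBits α.tail_pos, size]

theorem length_rest (w : List Bool) : (rest w).length = w.count true := by
  induction w with
  | nil => rfl
  | cons b w ih => cases b <;> simp [rest, ih]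

theorem getElem?_replicate_append {n j : ℕ} {w : List Bool} :
    (List.replicate n false ++ w)[j]? = some true ↔ ∃ i, n + i = j ∧ w[i]? = some true := by
  constructor
  · intro h
    by_cases hj : j < n
    · rw [List.getElem?_append_left (by simpa using hj), List.getElem?_replicate, if_pos hj] at h
      simp at h
    · rw [List.getElem?_append_right (by simpa using hj), List.length_replicate] at h
      exact ⟨j - n, by omega, h⟩
  · rintro ⟨i, rfl, h⟩
    rw [List.getElem?_append_right (by simp), List.length_replicate, Nat.add_sub_cancel_left, h]

theorem getElem?_tailBits {t : List ℕ} (ht : ∀ x ∈ t, 0 < x) {j : ℕ} :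
    (tailBits t)[j]? = some true ↔ ∃ k < t.length, (t.take k).sum = j := by
  induction t generalizing j with
  | nil => simp [tailBits]
  | cons b t ih =>
    have hb := ht b (by simp)
    have ih := @ih fun x hx => ht x (by simp [hx])
    rw [tailBits]
    constructor
    · intro h
      rcases j with _ | j
      · exact ⟨0, by simp, by simp⟩
      · rw [List.getElem?_cons_succ, getElem?_replicate_append] at h
        obtain ⟨i, hi, h⟩ := h
        obtain ⟨k, hk, rfl⟩ := ih.1 h
        refine ⟨k + 1, by simpa using hk, ?_⟩
        rw [List.take_succ_cons, List.sum_cons]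
        omega
    · rintro ⟨k, hk, rfl⟩
      rcases k with _ | k
      · simp
      · obtain ⟨c, rfl⟩ := Nat.exists_eq_add_of_lt hb
        rw [List.take_succ_cons, List.sum_cons,
          show 0 + c + 1 + (t.take k).sum = c + (t.take k).sum + 1 by omega,
          List.getElem?_cons_succ, getElem?_replicate_append]
        exact ⟨_, by omega, ih.2 ⟨k, by simpa using hk, rfl⟩⟩

theorem mem_partialSums {α : PseudoComposition} {j : ℕ} :
    j ∈ α.partialSums ↔ (bits α)[j]? = some true := by
  rw [bits, getElem?_replicate_append, partialSums, Finset.mem_image]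
  simp only [getElem?_tailBits α.tail_pos, Finset.mem_range]
  constructor
  · rintro ⟨k, hk, rfl⟩
    exact ⟨_, rfl, k, hk, rfl⟩
  · rintro ⟨_, rfl, k, hk, rfl⟩
    exact ⟨k, hk, rfl⟩

theorem le_iff_bits {α β : PseudoComposition} : α.Le β ↔ le (bits α) (bits β) = true := by
  rw [BinaryWord.le_iff, length_bits, length_bits, Le, Finset.subset_iff]
  simp only [mem_partialSums]

/-- A nonempty word of a tail starts with true, so the incoming state q has no effect; leaving it
free lets the induction pass over parts equal to 1. -/
theorem tailBits_star (q : Bool) {t : List ℕ} (ht : ∀ x ∈ t, 0 < x) :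
    tailBits (t.flatMap fun b => if 2 ≤ b then [1, b - 1] else [b]) =
      BinaryWord.star q (tailBits t) := by
  induction t generalizing q with
  | nil => rfl
  | cons b t ih =>
    have hb := ht b (by simp)
    have ih := fun q => @ih q fun x hx => ht x (by simp [hx])
    rw [List.flatMap_cons]
    obtain ⟨c, rfl⟩ := Nat.exists_eq_add_of_lt hb
    rcases c with _ | c
    · simp [tailBits, BinaryWord.star, ih true]
    · rw [if_pos (by omega)]
      simp [tailBits, BinaryWord.star, List.replicate_succ, ih false, star_replicate]

theorem bits_star (α : PseudoComposition) : bits α.star = BinaryWord.star false (bits α) := by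
  rw [bits, bits, star_replicate, ← tailBits_star false α.tail_pos]
  rfl

/-- A run of r pending ones has already produced one true and r - 1 false, and its last position
lies in the original set exactly when r is positive; this is the state handed to `BinaryWord.hat`.
-/
theorem tailBits_hatList (r : ℕ) {t : List ℕ} (ht : ∀ x ∈ t, 0 < x) :
    tailBits (hatList r t) =
      tailBits (if r = 0 then [] else [r]) ++ BinaryWord.hat (decide (0 < r)) (tailBits t) := by
  induction t generalizing r with
  | nil => simp [hatList, tailBits, BinaryWord.hat]
  | cons b t ih =>
    have hb := ht b (by simp)
    have ih := fun r => @ih r fun x hx => ht x (by simp [hx])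
    obtain ⟨c, rfl⟩ := Nat.exists_eq_add_of_lt hb
    rcases c with _ | c
    · rw [hatList, if_pos rfl, ih]
      rcases r with _ | r
      · simp [tailBits, BinaryWord.hat]
      · simp [tailBits, BinaryWord.hat, List.replicate_succ']
    · rw [hatList, if_neg (by omega), tailBits, ih]
      rcases r with _ | r
      · simp [tailBits, BinaryWord.hat, List.replicate_succ, hat_replicate]
      -- The zeros of the merged part: r from the pending run, one where the start of the present
      -- part is erased, and 1 + c from its interior, the first of which resets the state.
      · rw [show 0 + (c + 1) + 1 + (r + 1) - 1 = r + (1 + (1 + c)) by omega,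
          List.replicate_add, List.replicate_add, List.replicate_add]
        simp [tailBits, BinaryWord.hat, List.replicate_succ, hat_replicate]

theorem bits_hat (α : PseudoComposition) : bits α.hat = BinaryWord.hat false (bits α) := by
  rw [bits, bits, hat_replicate]
  congr 1
  exact tailBits_hatList 0 α.tail_pos

theorem sum_ofSize {E : Type*} [AddCommMonoid E] (n : ℕ) (f : PseudoComposition → E) :
    ∑ β ∈ ofSize n, f β = ∑ v ∈ words n, f (ofBits v) := by
  refine Finset.sum_bij' (fun β _ => bits β) (fun v _ => ofBits v) (fun β h => ?_) (fun v h => ?_)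
    (fun β _ => ofBits_bits β) (fun v _ => bits_ofBits v) fun β _ => by rw [ofBits_bits]
  · rw [mem_words, length_bits, mem_ofSize.1 h]
  · rw [mem_ofSize, ← length_bits, bits_ofBits, mem_words.1 h]

theorem isPeak_hatList (r : ℕ) {t : List ℕ} (ht : ∀ x ∈ t, 0 < x) :
    ∀ x ∈ (hatList r t).dropLast, 1 < x := by
  induction t generalizing r with
  | nil =>
    rw [hatList]
    split_ifs <;> simp
  | cons b t ih =>
    have hb := ht b (by simp)
    have ih := fun r => @ih r fun x hx => ht x (by simp [hx])
    rw [hatList]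
    split_ifs with h
    · exact ih _
    · intro x hx
      rcases hl : hatList 0 t with _ | ⟨c, l⟩
      · simp [hl] at hx
      · have h0 := ih 0
        rw [hl] at h0 hx
        rw [List.dropLast_cons_cons, List.mem_cons] at hx
        rcases hx with rfl | hx
        · omega
        · exact h0 x hx

theorem isPeak_hat (α : PseudoComposition) : α.hat.IsPeak := isPeak_hatList 0 α.tail_pos

theorem hatList_eq_self {t : List ℕ} (h : ∀ x ∈ t.dropLast, 1 < x) : hatList 0 t = t := by
  induction t with
  | nil => rfl
  | cons b t ih =>
    rcases t with _ | ⟨c, t⟩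
    · by_cases hb : b = 1 <;> simp [hatList, hb]
    · rw [List.dropLast_cons_cons] at h
      rw [hatList, if_neg (by have := h b (by simp); omega), ih fun x hx => h x (by simp [hx]),
        add_zero]

theorem hat_eq_self {α : PseudoComposition} (h : α.IsPeak) : α.hat = α :=
  PseudoComposition.ext rfl (hatList_eq_self h)

end PseudoComposition

/-! ### The image of the fundamental functions. -/

namespace BQSym
open BinaryWord

theorem M_ofBits_false (v : List Bool) : M (ofBits (false :: v)) = x₀ * M (ofBits v) :=
  (x₀_mul_M _ _).symm

theorem M_ofBits_true (v : List Bool) : M (ofBits (true :: v)) = mono (first 1 v :: rest v) := rfl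

theorem F_eq_sum (α : PseudoComposition) : F α = ∑ v ∈ ups (bits α), M (ofBits v) := by
  classical
  rw [F, Finset.sum_filter, sum_ofSize, ups, Finset.sum_filter, length_bits]
  refine Finset.sum_congr rfl fun v _ => ?_
  simp only [le_iff_bits, bits_ofBits]

theorem K_eq_sum (α : PseudoComposition) : K α = ∑ v ∈ words (bits α).length,
    (if le (bits α) (BinaryWord.star false v) then (2 : ℤ) ^ v.count true else 0) •
      M (ofBits v) := by
  classical
  rw [K, Finset.sum_filter, sum_ofSize, length_bits]
  refine Finset.sum_congr rfl fun v _ => ?_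
  rw [le_iff_bits, bits_star, bits_ofBits]
  split_ifs
  · rw [zsmul_eq_mul, Int.cast_pow, ← length_rest]
    simp [ofBits, ofParts]
  · rw [zero_smul]

/-- A leading false is a factor x₀, which the map fixes; from the first true on, the function is
some `mono` and the closing and continuing sums add up to 2 `weight true`. -/
theorem peakHom_sum_ups (w : List Bool) : peakHom (∑ v ∈ ups w, M (ofBits v)) =
    ∑ u ∈ words w.length, weight false u w • M (ofBits u) := by
  have ht (w : List Bool) : peakHom (∑ v ∈ ups w, M (ofBits (true :: v))) =
      ∑ u ∈ words w.length, (2 * weight true u w) • M (ofBits (true :: u)) := by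
    simp only [M_ofBits_true, map_sum, peakHom_mono, peak_first_rest]
    rw [← map_sum, Finset.sum_add_distrib, (sum_closing_continuing w 1).1,
      (sum_closing_continuing w 1).2, ← Finset.sum_add_distrib, map_sum]
    refine Finset.sum_congr rfl fun u _ => ?_
    rw [← add_smul, map_zsmul, ofWords_of, add_sub_cancel]
  induction w with
  | nil =>
    have h : M (ofBits []) = 1 := mono_nil
    simp [sum_ups_nil, words, weight, h]
  | cons b w ih =>
    cases b with
    | true =>
      rw [sum_ups_true, ht, List.length_cons, sum_words_succ]
      simp [weight]
    | false =>
      rw [sum_ups_false, map_add, ht, List.length_cons, sum_words_succ]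
      simp only [M_ofBits_false, ← Finset.mul_sum, map_mul, peakHom_x₀, ih, weight]
      rw [Finset.mul_sum]
      simp only [mul_smul_comm]

theorem peakHom_F (α : PseudoComposition) : peakHom (F α) = K α.hat := by
  have hl : (bits α.hat).length = (bits α).length := by
    rw [bits_hat]
    generalize bits α = w
    generalize false = p
    induction w generalizing p with
    | nil => rfl
    | cons b w ih => simp [BinaryWord.hat, ih]
  rw [F_eq_sum, peakHom_sum_ups, K_eq_sum, hl, bits_hat]
  refine Finset.sum_congr rfl fun v hv => ?_
  rw [← weight_eq (mem_words.1 hv) false false, Bool.or_false]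

theorem span_F : ⊤ ≤ Submodule.span ℤ (Set.range F) := by
  refine span_M.trans (Submodule.span_le.2 ?_)
  rintro _ ⟨α, rfl⟩
  rw [← ofBits_bits α]
  refine mem_of_sum_ups_mem _ (bits α) (fun v => M (ofBits v)) fun v _ => ?_
  rw [← bits_ofBits v, ← F_eq_sum]
  exact Submodule.subset_span ⟨_, rfl⟩

end BQSym

/-! ### Image, uniqueness and the Hopf subalgebra. -/

namespace BQSym

theorem range_peakHom : Subalgebra.toSubmodule peakHom.range = peakFunctions := by
  apply le_antisymm
  · rintro _ ⟨f, rfl⟩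
    have hf : f ∈ Submodule.span ℤ (Set.range F) := span_F trivial
    induction hf using Submodule.span_induction with
    | mem x hx =>
      obtain ⟨α, rfl⟩ := hx
      exact Submodule.subset_span ⟨α.hat, isPeak_hat α, peakHom_F α⟩
    | zero => exact (map_zero peakHom.toRingHom).symm ▸ zero_mem _
    | add x y _ _ hx hy => exact (map_add peakHom.toRingHom x y).symm ▸ add_mem hx hy
    | smul a x _ hx => exact (map_zsmul peakHom.toRingHom a x).symm ▸ Submodule.smul_mem _ a hx
  · refine Submodule.span_le.2 ?_
    rintro _ ⟨α, hα, rfl⟩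
    exact ⟨F α, (peakHom_F α).trans (by rw [hat_eq_self hα])⟩

theorem eq_peakHom (T : BQSym →ₗ[ℤ] BQSym) (hT : ∀ α, T (F α) = K α.hat) (f : BQSym) :
    T f = peakHom f := by
  have hf : f ∈ Submodule.span ℤ (Set.range F) := span_F trivial
  induction hf using Submodule.span_induction with
  | mem x hx =>
    obtain ⟨α, rfl⟩ := hx
    rw [hT, peakHom_F]
  | zero => rw [map_zero, map_zero]
  | add x y _ _ hx hy => rw [map_add, map_add, hx, hy]
  | smul a x _ hx => rw [map_zsmul, map_zsmul, hx]

section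
attribute [local instance 2000] TensorProduct.instModule Algebra.TensorProduct.leftAlgebra
attribute [local instance] bialgebra

theorem isHopfSubalgebra : IsHopfSubalgebra antipodeMap peakHom.range where
  tensor_injective := by
    have : Module.Free ℤ BQSym := Module.Free.of_basis basis
    -- A submodule of a free ℤ-module is flat, so tensoring the inclusion with itself stays
    -- injective.
    have : Module.Flat ℤ peakHom.range := inferInstance
    exact TensorProduct.map_injective_of_flat_flat _ _ Subtype.val_injective Subtype.val_injective
  comul_mem := by
    rintro _ ⟨f, rfl⟩
    -- Since Δ(Θf) = (Θ ⊗ Θ)(Δf), the preimage is Δf with Θ applied in both factors, corestricted to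
    -- the image.
    refine ⟨TensorProduct.map peakHom.rangeRestrict.toLinearMap peakHom.rangeRestrict.toLinearMap
      (comulHom f), ?_⟩
    have h := DFunLike.congr_fun map_peakHom_comulHom f
    refine Eq.trans ?_ h
    rw [← LinearMap.comp_apply, ← TensorProduct.map_comp]
    rfl
  antipode_mem := by
    rintro _ ⟨f, rfl⟩
    exact ⟨antipodeMap f, bialgHom_antipodeMap peakBialgHom f⟩

end

end BQSym

end

theorem mainTheorem2 :
    ∃ (_ : Coalgebra ℤ BQSym) (S : BQSym →ₗ[ℤ] BQSym),
      BQSym.HasStandardCoalgebra ∧ IsHopfAlgebra S ∧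
      ∃ Θ : BQSym →ₐc[ℤ] BQSym,
        (∀ α : PseudoComposition, Θ (BQSym.F α) = BQSym.K α.hat) ∧
        (∀ T : BQSym →ₗ[ℤ] BQSym,
          (∀ α : PseudoComposition, T (BQSym.F α) = BQSym.K α.hat) → ∀ f, T f = Θ f) ∧
        (∀ f : BQSym, Θ (S f) = S (Θ f)) ∧
        Subalgebra.toSubmodule (Θ : BQSym →ₐ[ℤ] BQSym).range = BQSym.peakFunctions ∧
        IsHopfSubalgebra S (Θ : BQSym →ₐ[ℤ] BQSym).range ∧
        Θ (BQSym.M ⟨1, [], by simp⟩) = BQSym.M ⟨1, [], by simp⟩ ∧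
        ∃ (e : TensorProduct ℤ (Polynomial ℤ) BQSym.QSym ≃ₐ[ℤ] BQSym)
          (θ : BQSym.QSym →ₐ[ℤ] BQSym.QSym),
          (∀ (p : Polynomial ℤ) (q : BQSym.QSym),
            e (p ⊗ₜ[ℤ] q) = Polynomial.aeval (BQSym.M ⟨1, [], by simp⟩) p * (q : BQSym)) ∧
          (∀ q : BQSym.QSym, (θ q : BQSym) = Θ (q : BQSym)) ∧
          ∀ t, Θ (e t) = e (Algebra.TensorProduct.map (AlgHom.id ℤ (Polynomial ℤ)) θ t) := by
  exact ⟨BQSym.bialgebra.toCoalgebra, BQSym.antipodeMap, BQSym.hasStandardCoalgebra,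
    BQSym.isHopfAlgebra, BQSym.peakBialgHom, BQSym.peakHom_F, BQSym.eq_peakHom,
    BQSym.bialgHom_antipodeMap _, BQSym.range_peakHom, BQSym.isHopfSubalgebra, BQSym.peakHom_x₀,
    BQSym.polynomialTensorEquiv, BQSym.qsymPeakHom, BQSym.polynomialTensorEquiv_tmul,
    BQSym.coe_qsymPeakHom, BQSym.peakHom_polynomialTensorEquiv⟩
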